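/- All vector spaces are over $\mathbb Q$, subspaces of graded vector spaces are graded, and $(-)^\vee=\mathrm{Hom}(-,\mathbb Q)$ degree by degree. Let $(\Lambda V,d)$ be a minimal Sullivan algebra: $V=V^{\ge 1}$ is a graded vector space, $\Lambda V$ is the free graded commutative algebra on $V$, $d$ is a derivation of degree $1$ with $d^2=0$ and $d(V)\subset\Lambda^{\ge 2}V$, and $V=\bigcup_n V(n)$, where $V(0)=V\cap\ker d$ and $V(n+1)=V\cap d^{-1}(\Lambda V(n))$. Let $d_1$ be the derivation for which $d_1v$ is the component of $dv$ in $\Lambda^2V$, $v\in V$, and let $$V_0=V\cap\ker d_1,\qquad V_{n+1}=V\cap d_1^{-1}(\Lambda^2V_n),\quad n\ge 0 .$$ The homotopy Lie algebra $L_V=\{(L_V)_p\}_{p\ge 0}$ is given by a suspension isomorphism $s:(L_V)_p\cong (V^{p+1})^\vee$ and the bracket $\langle v,s[x,y]\rangle=(-1)^{\deg y+1}\langle d_1v;sx,sy\rangle$, where $\langle vw;sx,sy\rangle=\langle v,sy\rangle\langle w,sx\rangle+(-1)^{\deg v\deg w}\langle v,sx\rangle\langle w,sy\rangle$. For each finite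 dimensional $V_\alpha\subset V$ with $\Lambda V_\alpha$ preserved by $d$, let $L_\alpha$ be the homotopy Lie algebra of $\Lambda V_\alpha$, let $\rho_\alpha:L_V\to L_\alpha$ be dual to the inclusion, and let $L_\alpha^r$ be the linear span of the iterated commutators $[x_1,[x_2,\dots[x_{r-1},x_r]\dots]]$ of length $r$ in $L_\alpha$. The Sullivan lower central series is $L_V^{(r)}=\varprojlim_\alpha L_\alpha^r=\{x\in L_V : \rho_\alpha x\in L_\alpha^r\text{ for all }\alpha\}$, $r\ge 1$. Then, for all $n\ge 0$: (a) The linear maps $sL_V\to V_n^\vee$ given by restriction to $V_n$ factor over $sL_V\to s(L_V/L_V^{(n+2)})$ and give isomorphisms of degree $1$ $$L_V/L_V^{(n+2)}\;\stackrel{\cong}{\longrightarrow}\;V_n^\vee .$$ (b) Equivalently, $s$ restricts to isomorphisms $L_V^{(n+2)}\stackrel{\cong}{\longrightarrow}(V/V_n)^\vee$. (c) For $D=d$ and for $D=d_1$ let $\xi:H^{\ge 1}(\Lambda V,D)\to V$ be induced by division by $\Lambda^{\ge 2}V$, and let $\xi^\vee:L_V\to H^{\ge 1}(\Lambda V,D)^\vee$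 be the dual map of degree $1$ (the Hurewicz map). For $D=d$ the map $\xi^\vee$ factors through $L_V/L_V^{(2)}$. For $D=d_1$ the map $\xi$ is a surjection $H^{\ge 1}(\Lambda V,d_1)\to V_0$ followed by the inclusion $V_0\subset V$, and $\xi^\vee$ factors as $$L_V\to L_V/L_V^{(2)}\stackrel{\cong}{\longrightarrow}V_0^\vee\hookrightarrow H^{\ge 1}(\Lambda V,d_1)^\vee,$$ where the isomorphism is that of (a) for $n=0$ and the injection is dual to the surjection. -/

import Mathlib

open scoped DirectSum

noncomputable section

namespace Sullivan

universe u

/-! ### Free graded commutative algebras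

A graded vector space is a family `V : ℕ → Type u` of rational vector spaces; a graded subspace is
a family `S i` of subspaces of `V i`. -/

section Free

variable (V : ℕ → Type u) [∀ i, AddCommGroup (V i)] [∀ i, Module ℚ (V i)]

/-- The relations `v w = (-1)^{ij} w v` for `v` of degree `i` and `w` of degree `j`. -/
inductive CommRel : TensorAlgebra ℚ (⨁ i, V i) → TensorAlgebra ℚ (⨁ i, V i) → Prop
  | comm (i j : ℕ) (v : V i) (w : V j) :
      CommRel
        (TensorAlgebra.ι ℚ (DirectSum.lof ℚ ℕ V i v) * TensorAlgebra.ι ℚ (DirectSum.lof ℚ ℕ V j w))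
        ((-1 : ℚ) ^ (i * j) •
          (TensorAlgebra.ι ℚ (DirectSum.lof ℚ ℕ V j w) *
            TensorAlgebra.ι ℚ (DirectSum.lof ℚ ℕ V i v)))

/-- The free graded commutative algebra `Λ V`. -/
def Free : Type u := RingQuot (CommRel V)

instance : Ring (Free V) := inferInstanceAs (Ring (RingQuot (CommRel V)))

instance : Algebra ℚ (Free V) := inferInstanceAs (Algebra ℚ (RingQuot (CommRel V)))

variable {V}

/-- The inclusion of the degree `i` generators `V i` in `Λ V`. -/
def ι (i : ℕ) : V i →ₗ[ℚ] Free V :=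
  (RingQuot.mkAlgHom ℚ (CommRel V)).toLinearMap ∘ₗ TensorAlgebra.ι ℚ ∘ₗ DirectSum.lof ℚ ℕ V i

theorem ι_mul_ι (i j : ℕ) (v : V i) (w : V j) :
    ι i v * ι j w = (-1 : ℚ) ^ (i * j) • (ι j w * ι i v) := by
  have h := RingQuot.mkAlgHom_rel ℚ (CommRel.comm i j v w)
  rw [map_mul, map_smul, map_mul] at h
  exact h

/-- The universal property of `Λ V`. -/
def lift {B : Type*} [Ring B] [Algebra ℚ B] (f : ∀ i, V i →ₗ[ℚ] B)
    (hf : ∀ i j (v : V i) (w : V j), f i v * f j w = (-1 : ℚ) ^ (i * j) • (f j w * f i v)) :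
    Free V →ₐ[ℚ] B :=
  RingQuot.liftAlgHom ℚ ⟨TensorAlgebra.lift ℚ (DirectSum.toModule ℚ ℕ B f), by
    rintro _ _ ⟨i, j, v, w⟩
    simpa using hf i j v w⟩

theorem lift_ι {B : Type*} [Ring B] [Algebra ℚ B] (f : ∀ i, V i →ₗ[ℚ] B)
    (hf : ∀ i j (v : V i) (w : V j), f i v * f j w = (-1 : ℚ) ^ (i * j) • (f j w * f i v))
    (i : ℕ) (v : V i) : lift f hf (ι i v) = f i v := by
  have h : lift f hf (RingQuot.mkAlgHom ℚ (CommRel V)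
      (TensorAlgebra.ι ℚ (DirectSum.lof ℚ ℕ V i v))) = f i v := by
    unfold lift
    erw [RingQuot.liftAlgHom_mkAlgHom_apply]
    simp
  exact h

theorem free_induction {C : Free V → Prop} (hc : ∀ c : ℚ, C (algebraMap ℚ (Free V) c))
    (hι : ∀ i (v : V i), C (ι i v)) (hm : ∀ Φ Ψ, C Φ → C Ψ → C (Φ * Ψ))
    (ha : ∀ Φ Ψ, C Φ → C Ψ → C (Φ + Ψ)) (Φ : Free V) : C Φ := by
  obtain ⟨T, rfl⟩ := RingQuot.mkAlgHom_surjective ℚ (CommRel V) Φ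
  induction T using TensorAlgebra.induction with
  | algebraMap c =>
    rw [AlgHom.commutes]
    exact hc c
  | ι x =>
    induction x using DirectSum.induction_on with
    | zero =>
      have h := hc 0
      rw [map_zero] at h
      rw [map_zero, map_zero]
      exact h
    | of i v => exact hι i v
    | add x y hx hy =>
      rw [map_add, map_add]
      exact ha _ _ hx hy
  | mul a b hA hB =>
    rw [map_mul]
    exact hm _ _ hA hB
  | add a b hA hB =>
    rw [map_add]
    exact ha _ _ hA hB

theorem algHom_ext {B : Type*} [Ring B] [Algebra ℚ B] {f g : Free V →ₐ[ℚ] B}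
    (h : ∀ i (v : V i), f (ι i v) = g (ι i v)) : f = g := by
  ext Φ
  induction Φ using free_induction with
  | hc c => simp
  | hι i v => exact h i v
  | hm Φ Ψ h1 h2 => simp [h1, h2]
  | ha Φ Ψ h1 h2 => simp [h1, h2]

/-- The copy of a graded subspace `S` inside `Λ V`. -/
def gens (S : ∀ i, Submodule ℚ (V i)) : Submodule ℚ (Free V) := ⨆ i, (S i).map (ι i)

/-- `Λ^p S`, the span of the products of `p` elements of the graded subspace `S`. -/
def wedge (S : ∀ i, Submodule ℚ (V i)) (p : ℕ) : Submodule ℚ (Free V) := gens S ^ p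

/-- `Λ S`, the subalgebra of `Λ V` generated by the graded subspace `S`. -/
def subalg (S : ∀ i, Submodule ℚ (V i)) : Subalgebra ℚ (Free V) :=
  Algebra.adjoin ℚ (gens S : Set (Free V))

variable (V) in
/-- `(Λ V)^n`, the span of the products `v₁ ⋯ v_k` of homogeneous generators whose degrees have
sum `n`. -/
def degPart (n : ℕ) : Submodule ℚ (Free V) :=
  ⨆ (l : List ℕ) (_ : l.sum = n), (l.map fun i => LinearMap.range (ι (V := V) i)).prod

variable (V) in
/-- `Λ^{≥ k} V`. -/
def wedgeGE (k : ℕ) : Submodule ℚ (Free V) :=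
  ⨆ (p : ℕ) (_ : k ≤ p), wedge (fun i => (⊤ : Submodule ℚ (V i))) p

/-- The morphism `Λ V → (Λ V)[X]` that sends `Φ ∈ Λ^p V` to `Φ X^p`. -/
def wedgeHom : Free V →ₐ[ℚ] Polynomial (Free V) :=
  lift (fun i => (Polynomial.monomial 1).restrictScalars ℚ ∘ₗ ι i) (by
    intro i j v w
    simp only [LinearMap.coe_comp, LinearMap.coe_restrictScalars, Function.comp_apply,
      Polynomial.monomial_mul_monomial, Polynomial.smul_monomial]
    rw [ι_mul_ι i j v w])

/-- The projection of `Λ V` onto `Λ^p V`. -/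
def wedgeProj (p : ℕ) : Free V →ₗ[ℚ] Free V :=
  (Polynomial.lcoeff (Free V) p).restrictScalars ℚ ∘ₗ wedgeHom.toLinearMap

/-- The augmentation `Λ V → ℚ`, zero on `V`. -/
def aug : Free V →ₐ[ℚ] ℚ := lift (fun _ => 0) (by simp)

/-- The action of `Λ V` on `ℚ ⊕ V` in which `v` sends `(a, w)` to `(0, a v)`. -/
def linAct : Free V →ₐ[ℚ] Module.End ℚ (ℚ × (⨁ i, V i)) :=
  lift
    (fun i =>
      { toFun := fun v => LinearMap.inr ℚ ℚ (⨁ i, V i) ∘ₗ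
          (LinearMap.fst ℚ ℚ (⨁ i, V i)).smulRight (DirectSum.lof ℚ ℕ V i v)
        map_add' := by intro v w; ext <;> simp
        map_smul' := by intro c v; ext <;> simp })
    (by intro i j v w; ext <;> simp)

/-- The projection `Λ V → V` that vanishes on `ℚ` and on `Λ^{≥ 2} V`: the image of `Φ` is the second
component of `Φ · (1, 0)` in `ℚ ⊕ V`. -/
def linPart : Free V →ₗ[ℚ] (⨁ i, V i) :=
  LinearMap.snd ℚ ℚ (⨁ i, V i) ∘ₗ
    LinearMap.applyₗ ((1, 0) : ℚ × (⨁ i, V i)) ∘ₗ linAct.toLinearMap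

theorem linAct_ι (i : ℕ) (v : V i) (z : ℚ × (⨁ i, V i)) :
    linAct (ι i v) z = (0, z.1 • DirectSum.lof ℚ ℕ V i v) := by
  simp [linAct, lift_ι]

theorem linPart_ι (i : ℕ) (v : V i) : linPart (ι i v) = DirectSum.lof ℚ ℕ V i v := by
  simp [linPart, linAct_ι]

/-- The functional on homogeneous elements that is `f` on `V a` and zero on `V i` for `i ≠ a`. -/
def extend (a : ℕ) (f : Module.Dual ℚ (V a)) (i : ℕ) : Module.Dual ℚ (V i) :=
  f ∘ₗ DirectSum.component ℚ ℕ V a ∘ₗ DirectSum.lof ℚ ℕ V i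

theorem extend_self (a : ℕ) (f : Module.Dual ℚ (V a)) (v : V a) : extend a f a v = f v := by
  simp [extend]

theorem extend_of_ne {a i : ℕ} (h : i ≠ a) (f : Module.Dual ℚ (V a)) (v : V i) :
    extend a f i v = 0 := by
  simp [extend, DirectSum.component.of, h]

theorem sign_mul_extend (a : ℕ) (f : Module.Dual ℚ (V a)) (i k : ℕ) (v : V i) :
    (-1 : ℚ) ^ (k * a) * extend a f i v = (-1 : ℚ) ^ (k * i) * extend a f i v := by
  by_cases h : i = a
  · subst h; rfl
  · rw [extend_of_ne h]; simp

/-- The multiplicative map from `Λ V` to triangular matrices with diagonal entries `± Φ` and `Φ`,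
whose upper right entry is the graded derivation, of degree `-a`, that extends `f : V a → ℚ`. -/
def contractHom (a : ℕ) (f : Module.Dual ℚ (V a)) :
    Free V →ₐ[ℚ] Matrix (Fin 2) (Fin 2) (Free V) :=
  lift
    (fun i =>
      { toFun := fun v =>
          !![(-1 : ℚ) ^ (a * i) • ι i v, algebraMap ℚ (Free V) (extend a f i v); 0, ι i v]
        map_add' := by
          intro v w
          ext r s
          fin_cases r <;> fin_cases s <;> simp
        map_smul' := by
          intro c v
          ext r s
          fin_cases r <;> fin_cases s <;> simp [Algebra.smul_def]
          rw [← Algebra.smul_def, ← Algebra.smul_def, mul_smul_comm] })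
    (by
      intro i j v w
      have hc := ι_mul_ι i j v w
      have h1 := sign_mul_extend a f j i w
      have h2 := sign_mul_extend a f i j v
      have hs : (-1 : ℚ) ^ (i * j) * (-1 : ℚ) ^ (i * j) = 1 := by
        rw [← mul_pow]; simp
      ext r s
      fin_cases r <;> fin_cases s
      · simp only [Matrix.mul_apply, Fin.sum_univ_two, Matrix.smul_apply]
        simp only [LinearMap.coe_mk, AddHom.coe_mk, Fin.zero_eta, Matrix.of_apply,
          Matrix.cons_val_zero, Matrix.cons_val_one, Matrix.cons_val_fin_one, mul_zero, add_zero,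
          smul_mul_smul_comm, hc, smul_smul]
        congr 1
        ring
      · simp only [Matrix.mul_apply, Fin.sum_univ_two, Matrix.smul_apply]
        simp only [LinearMap.coe_mk, AddHom.coe_mk, Fin.zero_eta, Fin.mk_one, Matrix.of_apply,
          Matrix.cons_val_zero, Matrix.cons_val_one, Matrix.cons_val_fin_one,
          ← Algebra.smul_def, ← Algebra.commutes, smul_add, smul_smul]
        rw [add_comm]
        congr 2
        · rw [mul_comm a j, mul_comm (extend a f i v), h2, mul_comm j i, ← mul_assoc, hs, one_mul]
        · rw [mul_comm a i]
          linear_combination h1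
      · simp
      · simp [hc])

/-- The graded derivation of `Λ V` that extends `f : V a → ℚ`. -/
def contract (a : ℕ) (f : Module.Dual ℚ (V a)) : Free V →ₗ[ℚ] Free V :=
  Matrix.entryLinearMap ℚ (Free V) 0 1 ∘ₗ (contractHom a f).toLinearMap

/-- The pairing `⟨Φ ; f, g⟩` of `Φ ∈ Λ² V` with two functionals on `V`. -/
def pairing {a b : ℕ} (f : Module.Dual ℚ (V a)) (g : Module.Dual ℚ (V b)) : Free V →ₗ[ℚ] ℚ :=
  aug.toLinearMap ∘ₗ contract a f ∘ₗ contract b g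

theorem contractHom_lower (a : ℕ) (f : Module.Dual ℚ (V a)) (Φ : Free V) :
    contractHom a f Φ 1 0 = 0 ∧ contractHom a f Φ 1 1 = Φ := by
  induction Φ using free_induction with
  | hc c => simp [Matrix.algebraMap_matrix_apply]
  | hι i v => simp [contractHom, lift_ι]
  | hm Φ Ψ h1 h2 => simp [Matrix.mul_apply, h1, h2]
  | ha Φ Ψ h1 h2 => simp [h1, h2]

theorem contract_one (a : ℕ) (f : Module.Dual ℚ (V a)) : contract a f 1 = 0 := by
  simp [contract]

theorem contract_ι_mul (a : ℕ) (f : Module.Dual ℚ (V a)) (i : ℕ) (v : V i) (Φ : Free V) :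
    contract a f (ι i v * Φ) =
      extend a f i v • Φ + (-1 : ℚ) ^ (a * i) • (ι i v * contract a f Φ) := by
  have h : contractHom a f (ι i v) = !![(-1 : ℚ) ^ (a * i) • ι i v,
      algebraMap ℚ (Free V) (extend a f i v); 0, ι i v] := by
    rw [contractHom, lift_ι]; rfl
  change contractHom a f (ι i v * Φ) 0 1 = _ + _ • (_ * contractHom a f Φ 0 1)
  rw [map_mul, Matrix.mul_apply, Fin.sum_univ_two, (contractHom_lower a f Φ).2, h]
  simp only [Matrix.of_apply, Matrix.cons_val_zero, Matrix.cons_val_one, Matrix.cons_val_fin_one,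
    smul_mul_assoc, Algebra.smul_def (extend a f i v)]
  rw [add_comm]

theorem contract_ι (a : ℕ) (f : Module.Dual ℚ (V a)) (i : ℕ) (v : V i) :
    contract a f (ι i v) = algebraMap ℚ (Free V) (extend a f i v) := by
  rw [← mul_one (ι i v), contract_ι_mul, contract_one, Algebra.smul_def]
  simp

theorem aug_ι (i : ℕ) (v : V i) : aug (ι i v) = 0 := by
  simp [aug, lift_ι]

/-- `⟨v w ; f, g⟩ = g(v) f(w) + (-1)^{|v||w|} f(v) g(w)`. -/
theorem pairing_ι_mul_ι {a b : ℕ} (f : Module.Dual ℚ (V a)) (g : Module.Dual ℚ (V b))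
    (i j : ℕ) (v : V i) (w : V j) :
    pairing f g (ι i v * ι j w) =
      extend b g i v * extend a f j w + (-1 : ℚ) ^ (i * j) * (extend a f i v * extend b g j w) := by
  have h := sign_mul_extend b g j i w
  simp only [pairing, LinearMap.comp_apply, contract_ι_mul, contract_ι, map_add, map_smul,
    ← Algebra.commutes, ← Algebra.smul_def, AlgHom.toLinearMap_apply,
    AlgHom.commutes, smul_eq_mul, Algebra.algebraMap_self, RingHom.id_apply]
  rw [mul_comm b i]
  linear_combination (extend a f i v) * h

/-- The algebra morphism `Λ V → Λ W` induced by a degree zero linear map `V → W`. -/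
def map {W : ℕ → Type u} [∀ i, AddCommGroup (W i)] [∀ i, Module ℚ (W i)]
    (f : ∀ i, V i →ₗ[ℚ] W i) : Free V →ₐ[ℚ] Free W :=
  lift (fun i => ι i ∘ₗ f i) (fun i j v w => ι_mul_ι i j (f i v) (f j w))

theorem map_ι {W : ℕ → Type u} [∀ i, AddCommGroup (W i)] [∀ i, Module ℚ (W i)]
    (f : ∀ i, V i →ₗ[ℚ] W i) (i : ℕ) (v : V i) : map f (ι i v) = ι i (f i v) :=
  lift_ι _ _ i v

theorem map_degPart {W : ℕ → Type u} [∀ i, AddCommGroup (W i)] [∀ i, Module ℚ (W i)]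
    (f : ∀ i, V i →ₗ[ℚ] W i) {n : ℕ} {Φ : Free V} (h : Φ ∈ degPart V n) :
    map f Φ ∈ degPart W n := by
  have key : ∀ l : List ℕ, (l.map fun i => LinearMap.range (ι (V := V) i)).prod ≤
      ((l.map fun i => LinearMap.range (ι (V := W) i)).prod).comap (map f).toLinearMap := by
    intro l
    induction l with
    | nil =>
      simp only [List.map_nil, List.prod_nil]
      rw [Submodule.one_le]
      simpa using ⟨1, map_one _⟩
    | cons i l ih =>
      simp only [List.map_cons, List.prod_cons]
      rw [Submodule.mul_le]
      rintro _ ⟨v, rfl⟩ Ψ hΨ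
      simp only [Submodule.mem_comap, AlgHom.toLinearMap_apply, map_mul, map_ι]
      exact Submodule.mul_mem_mul ⟨_, rfl⟩ (ih hΨ)
  have : degPart V n ≤ (degPart W n).comap (map f).toLinearMap := by
    refine iSup₂_le fun l hl => (key l).trans (Submodule.comap_mono ?_)
    exact le_iSup₂_of_le l hl le_rfl
  exact this h

theorem ι_mem_gens (i : ℕ) (v : V i) : ι i v ∈ gens (fun i => (⊤ : Submodule ℚ (V i))) :=
  Submodule.mem_iSup_of_mem i ⟨v, trivial, rfl⟩

theorem gens_eq_range (S : ∀ i, Submodule ℚ (V i)) :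
    ∀ Φ ∈ gens S, Φ ∈ (map fun i => (S i).subtype).range := by
  have : gens S ≤ (Subalgebra.toSubmodule (map fun i => (S i).subtype).range) := by
    refine iSup_le fun i => ?_
    rintro _ ⟨v, hv, rfl⟩
    exact ⟨ι i ⟨v, hv⟩, map_ι _ _ _⟩
  exact fun Φ h => this h

/-- `Λ S` is the image of the morphism induced by the inclusion of `S`. -/
theorem subalg_eq_range (S : ∀ i, Submodule ℚ (V i)) :
    subalg S = (map fun i => (S i).subtype).range := by
  apply le_antisymm
  · exact Algebra.adjoin_le (gens_eq_range S)
  · rintro _ ⟨Φ, rfl⟩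
    induction Φ using free_induction with
    | hc c =>
      simp only [AlgHom.toRingHom_eq_coe, RingHom.coe_coe, AlgHom.commutes]
      exact Subalgebra.algebraMap_mem _ c
    | hι i v =>
      simp only [AlgHom.toRingHom_eq_coe, RingHom.coe_coe, map_ι]
      exact Algebra.subset_adjoin (Submodule.mem_iSup_of_mem i ⟨v, v.2, rfl⟩)
    | hm Φ Ψ h1 h2 =>
      rw [map_mul]
      exact mul_mem h1 h2
    | ha Φ Ψ h1 h2 =>
      rw [map_add]
      exact add_mem h1 h2

theorem wedge_induction {C : Free V → Prop}
    (hw : ∀ p, ∀ Φ ∈ wedge (fun i => (⊤ : Submodule ℚ (V i))) p, C Φ)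
    (ha : ∀ Φ Ψ, C Φ → C Ψ → C (Φ + Ψ)) (Φ : Free V) : C Φ := by
  have hmem : ∀ Φ : Free V, Φ ∈ ⨆ p, wedge (fun i => (⊤ : Submodule ℚ (V i))) p := by
    intro Φ
    induction Φ using free_induction with
    | hc c =>
      refine Submodule.mem_iSup_of_mem 0 ?_
      rw [wedge, pow_zero]
      exact Submodule.mem_one.2 ⟨c, rfl⟩
    | hι i v =>
      refine Submodule.mem_iSup_of_mem 1 ?_
      rw [wedge, pow_one]
      exact ι_mem_gens i v
    | hm Φ Ψ h1 h2 =>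
      refine Submodule.iSup_induction _ (motive := fun Φ => Φ * Ψ ∈ _) h1 (fun p Φ hp => ?_)
        (by simp) (fun x y hx hy => by rw [add_mul]; exact add_mem hx hy)
      refine Submodule.iSup_induction _ (motive := fun Ψ => Φ * Ψ ∈ _) h2 (fun q Ψ hq => ?_)
        (by simp) (fun x y hx hy => by rw [mul_add]; exact add_mem hx hy)
      refine Submodule.mem_iSup_of_mem (p + q) ?_
      rw [wedge, pow_add]
      exact Submodule.mul_mem_mul hp hq
    | ha Φ Ψ h1 h2 => exact add_mem h1 h2
  exact Submodule.iSup_induction _ (motive := C) (hmem Φ) hw (hw 0 0 (zero_mem _)) ha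

theorem wedgeHom_ι (i : ℕ) (v : V i) : wedgeHom (ι i v) = Polynomial.monomial 1 (ι i v) :=
  lift_ι _ _ i v

theorem wedgeHom_of_mem {p : ℕ} {Φ : Free V}
    (h : Φ ∈ wedge (fun i => (⊤ : Submodule ℚ (V i))) p) :
    wedgeHom Φ = Polynomial.monomial p Φ := by
  induction h using Submodule.pow_induction_on_left' with
  | algebraMap c =>
    rw [AlgHom.commutes, Polynomial.monomial_zero_left, Polynomial.algebraMap_apply]
  | add x y i hx hy h1 h2 => rw [map_add, map_add, h1, h2]
  | mem_mul m hm i x hx ih =>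
    have hm' : wedgeHom m = Polynomial.monomial 1 m := by
      refine Submodule.iSup_induction _ (motive := fun m => wedgeHom m = Polynomial.monomial 1 m)
        hm ?_ (by simp) (fun x y h1 h2 => by rw [map_add, map_add, h1, h2])
      rintro j _ ⟨v, -, rfl⟩
      exact wedgeHom_ι j v
    rw [map_mul, ih, hm', Polynomial.monomial_mul_monomial, add_comm]

theorem wedgeProj_of_mem {p : ℕ} {Φ : Free V}
    (h : Φ ∈ wedge (fun i => (⊤ : Submodule ℚ (V i))) p) (q : ℕ) :
    wedgeProj q Φ = if p = q then Φ else 0 := by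
  change (wedgeHom Φ).coeff q = _
  rw [wedgeHom_of_mem h, Polynomial.coeff_monomial]

theorem wedgeProj_mul_right {p : ℕ} {Ψ : Free V}
    (h : Ψ ∈ wedge (fun i => (⊤ : Submodule ℚ (V i))) p) (q : ℕ) (Φ : Free V) :
    wedgeProj (q + p) (Φ * Ψ) = wedgeProj q Φ * Ψ := by
  change (wedgeHom (Φ * Ψ)).coeff (q + p) = (wedgeHom Φ).coeff q * Ψ
  rw [map_mul, wedgeHom_of_mem h, Polynomial.coeff_mul_monomial]

theorem wedgeProj_mul_right_lt {p : ℕ} {Ψ : Free V}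
    (h : Ψ ∈ wedge (fun i => (⊤ : Submodule ℚ (V i))) p) {q : ℕ} (hq : q < p) (Φ : Free V) :
    wedgeProj q (Φ * Ψ) = 0 := by
  change (wedgeHom (Φ * Ψ)).coeff q = 0
  rw [map_mul, wedgeHom_of_mem h, ← Polynomial.C_mul_X_pow_eq_monomial, ← mul_assoc,
    Polynomial.coeff_mul_X_pow', if_neg (by omega)]

theorem wedgeProj_mul_left {p : ℕ} {Φ : Free V}
    (h : Φ ∈ wedge (fun i => (⊤ : Submodule ℚ (V i))) p) (q : ℕ) (Ψ : Free V) :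
    wedgeProj (q + p) (Φ * Ψ) = Φ * wedgeProj q Ψ := by
  change (wedgeHom (Φ * Ψ)).coeff (q + p) = Φ * (wedgeHom Ψ).coeff q
  rw [map_mul, wedgeHom_of_mem h, Polynomial.coeff_monomial_mul]

theorem wedgeProj_mem (p : ℕ) (Φ : Free V) :
    wedgeProj p Φ ∈ wedge (fun i => (⊤ : Submodule ℚ (V i))) p := by
  induction Φ using wedge_induction with
  | hw q Φ h =>
    rw [wedgeProj_of_mem h]
    split_ifs with hq
    · exact hq ▸ h
    · exact zero_mem _
  | ha Φ Ψ h1 h2 =>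
    rw [map_add]
    exact add_mem h1 h2

theorem prod_le_wedge (l : List ℕ) : (l.map fun i => LinearMap.range (ι (V := V) i)).prod ≤
    wedge (fun i => (⊤ : Submodule ℚ (V i))) l.length := by
  induction l with
  | nil => simp [wedge]
  | cons i l ih =>
    simp only [List.map_cons, List.prod_cons, List.length_cons]
    rw [wedge, pow_succ']
    refine mul_le_mul' ?_ ih
    rintro _ ⟨v, rfl⟩
    exact ι_mem_gens i v

theorem degPart_induction {n : ℕ} {C : Free V → Prop}
    (hw : ∀ p, ∀ Φ ∈ wedge (fun i => (⊤ : Submodule ℚ (V i))) p, Φ ∈ degPart V n → C Φ)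
    (ha : ∀ Φ Ψ, C Φ → C Ψ → C (Φ + Ψ)) {Φ : Free V} (h : Φ ∈ degPart V n) : C Φ := by
  have h0 : C 0 := hw 0 0 (zero_mem _) (zero_mem _)
  refine Submodule.iSup_induction _ (motive := C) h (fun l Ψ hΨ => ?_) h0 ha
  by_cases hl : l.sum = n
  · simp only [hl, iSup_pos] at hΨ
    exact hw l.length Ψ (prod_le_wedge l hΨ) (Submodule.mem_iSup_of_mem l (by simpa [hl] using hΨ))
  · simp only [hl, not_false_eq_true, iSup_neg, Submodule.mem_bot] at hΨ
    exact hΨ ▸ h0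

theorem linAct_gens {m : Free V} (hm : m ∈ gens (fun i => (⊤ : Submodule ℚ (V i))))
    (z : ℚ × (⨁ i, V i)) : linAct m z = (0, z.1 • linPart m) := by
  refine Submodule.iSup_induction _ (motive := fun m => linAct m z = (0, z.1 • linPart m))
    hm ?_ (by rw [map_zero, map_zero, smul_zero]; rfl) (fun x y h1 h2 => ?_)
  · rintro j _ ⟨v, -, rfl⟩
    rw [linAct_ι, linPart_ι]
  · rw [map_add, map_add, LinearMap.add_apply, h1, h2]
    simp

theorem linPart_wedge {p : ℕ} (hp : p ≠ 1) {Φ : Free V}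
    (h : Φ ∈ wedge (fun i => (⊤ : Submodule ℚ (V i))) p) : linPart Φ = 0 := by
  rcases p with _ | _ | p
  · rw [wedge, pow_zero] at h
    obtain ⟨c, rfl⟩ := Submodule.mem_one.1 h
    simp [linPart]
  · exact absurd rfl hp
  · rw [wedge, pow_succ', pow_succ'] at h
    refine Submodule.mul_induction_on h (fun m hm x hx => ?_)
      (fun x y h1 h2 => by rw [map_add, h1, h2, add_zero])
    have hx0 : (linAct x ((1, 0) : ℚ × (⨁ i, V i))).1 = 0 := by
      refine Submodule.mul_induction_on hx (fun m hm y _ => ?_) (fun x y h1 h2 => ?_)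
      · rw [map_mul, Module.End.mul_apply, linAct_gens hm]
      · rw [map_add, LinearMap.add_apply, Prod.fst_add, h1, h2, add_zero]
    change (linAct (m * x) ((1, 0) : ℚ × (⨁ i, V i))).2 = 0
    rw [map_mul, Module.End.mul_apply, linAct_gens hm, hx0, zero_smul]

theorem linPart_wedgeProj (Φ : Free V) : linPart (wedgeProj 1 Φ) = linPart Φ := by
  induction Φ using wedge_induction with
  | hw p Φ h =>
    rw [wedgeProj_of_mem h]
    split_ifs with hp
    · rfl
    · rw [map_zero, linPart_wedge hp h]
  | ha Φ Ψ h1 h2 => simp only [map_add, h1, h2]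

theorem wedgeProj_degPart (p : ℕ) {n : ℕ} {Φ : Free V} (h : Φ ∈ degPart V n) :
    wedgeProj p Φ ∈ degPart V n := by
  refine degPart_induction (C := fun Φ => wedgeProj p Φ ∈ degPart V n) (fun q Φ h h' => ?_)
    (fun Φ Ψ h1 h2 => ?_) h
  · rw [wedgeProj_of_mem h]
    split_ifs
    · exact h'
    · exact zero_mem _
  · rw [map_add]
    exact add_mem h1 h2

end Free

/-! ### Differentials on `Λ V` -/

/-- A commutative differential graded algebra of the form `(Λ V, d)`. -/
structure FreeCDGA (V : ℕ → Type u) [∀ i, AddCommGroup (V i)] [∀ i, Module ℚ (V i)] where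
  d : Free V →ₗ[ℚ] Free V
  d_mem : ∀ n, ∀ Φ ∈ degPart V n, d Φ ∈ degPart V (n + 1)
  leibniz : ∀ n, ∀ Φ ∈ degPart V n, ∀ Ψ, d (Φ * Ψ) = d Φ * Ψ + (-1 : ℚ) ^ n • (Φ * d Ψ)
  d_d : ∀ Φ, d (d Φ) = 0

namespace FreeCDGA

variable {V : ℕ → Type u} [∀ i, AddCommGroup (V i)] [∀ i, Module ℚ (V i)] (A : FreeCDGA V)

/-- The filtration `V(0) = V ∩ ker d`, `V(n+1) = V ∩ d⁻¹(Λ V(n))`. -/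
def filtration : ℕ → ∀ i, Submodule ℚ (V i)
  | 0, i => (LinearMap.ker A.d).comap (ι i)
  | n + 1, i => (Subalgebra.toSubmodule (subalg (filtration n))).comap (A.d ∘ₗ ι i)

/-- `(Λ V, d)` is a Sullivan algebra: `V = V^{≥ 1}` and `V = ⋃ V(n)`. -/
def IsSullivan : Prop :=
  Subsingleton (V 0) ∧ ∀ i (v : V i), ∃ n, v ∈ A.filtration n i

/-- `(Λ V, d)` is minimal: `d` maps `V` to `Λ^{≥ 2} V`. -/
def IsMinimal : Prop := ∀ i (v : V i), A.d (ι i v) ∈ wedgeGE V 2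

/-- The part `d₁` of `d` that raises the wedge degree by one: for `Φ ∈ Λ^p V`, `d₁ Φ` is the
component of `d Φ` in `Λ^{p+1} V`. -/
def quadD : Free V →ₗ[ℚ] Free V :=
  Polynomial.lsum (R := ℚ) (A := Free V) (fun p => wedgeProj (p + 1) ∘ₗ A.d) ∘ₗ
    wedgeHom.toLinearMap

theorem quadD_of_mem {p : ℕ} {Φ : Free V}
    (h : Φ ∈ wedge (fun i => (⊤ : Submodule ℚ (V i))) p) :
    A.quadD Φ = wedgeProj (p + 1) (A.d Φ) := by
  change Polynomial.lsum (R := ℚ) (A := Free V) (fun p => wedgeProj (p + 1) ∘ₗ A.d)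
    (wedgeHom Φ) = _
  rw [wedgeHom_of_mem h, Polynomial.lsum_apply, Polynomial.sum_monomial_index]
  · rfl
  · simp

/-- `d₁ v` is the component of `d v` in `Λ² V`. -/
theorem quadD_ι (i : ℕ) (v : V i) : A.quadD (ι i v) = wedgeProj 2 (A.d (ι i v)) :=
  A.quadD_of_mem (by rw [wedge, pow_one]; exact ι_mem_gens i v)

theorem quadD_mem (n : ℕ) (Φ : Free V) (h : Φ ∈ degPart V n) :
    A.quadD Φ ∈ degPart V (n + 1) := by
  refine degPart_induction (C := fun Φ => A.quadD Φ ∈ degPart V (n + 1)) (fun q Φ h h' => ?_)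
    (fun Φ Ψ h1 h2 => ?_) h
  · rw [A.quadD_of_mem h]
    exact wedgeProj_degPart _ (A.d_mem n Φ h')
  · rw [map_add]
    exact add_mem h1 h2

theorem quadD_leibniz (n : ℕ) (Φ : Free V) (h : Φ ∈ degPart V n) (Ψ : Free V) :
    A.quadD (Φ * Ψ) = A.quadD Φ * Ψ + (-1 : ℚ) ^ n • (Φ * A.quadD Ψ) := by
  refine degPart_induction
    (C := fun Φ => A.quadD (Φ * Ψ) = A.quadD Φ * Ψ + (-1 : ℚ) ^ n • (Φ * A.quadD Ψ))
    (fun p Φ hp h' => ?_) (fun Φ Φ' h1 h2 => ?_) h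
  · induction Ψ using wedge_induction with
    | hw q Ψ hq =>
      have hpq : Φ * Ψ ∈ wedge (fun i => (⊤ : Submodule ℚ (V i))) (p + q) := by
        rw [wedge, pow_add]
        exact Submodule.mul_mem_mul hp hq
      rw [A.quadD_of_mem hp, A.quadD_of_mem hq, A.quadD_of_mem hpq, A.leibniz n Φ h' Ψ, map_add,
        map_smul]
      congr 2
      · rw [← wedgeProj_mul_right hq, add_right_comm]
      · rw [← wedgeProj_mul_left hp, add_comm p q, add_right_comm]
    | ha Ψ Ψ' h1 h2 =>
      rw [mul_add, map_add, map_add, h1, h2]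
      simp only [mul_add, smul_add]
      abel
  · rw [add_mul, map_add, map_add, h1, h2]
    simp only [add_mul, smul_add]
    abel

variable {A}

theorem d_one : A.d 1 = 0 := by
  have h1 : (1 : Free V) ∈ degPart V 0 :=
    Submodule.mem_iSup_of_mem [] (by simpa using ⟨1, map_one _⟩)
  have h := A.leibniz 0 1 h1 1
  simpa using h

theorem IsMinimal.wedgeProj_d_ι (hM : A.IsMinimal) (i : ℕ) (v : V i) {q : ℕ} (hq : q ≤ 1) :
    wedgeProj q (A.d (ι i v)) = 0 := by
  have h : wedgeGE V 2 ≤ LinearMap.ker (wedgeProj (V := V) q) := by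
    refine iSup₂_le fun p hp Φ hΦ => ?_
    rw [LinearMap.mem_ker, wedgeProj_of_mem hΦ, if_neg (by omega)]
  exact h (hM i v)

/-- In a minimal algebra `d` raises the wedge degree. -/
theorem IsMinimal.wedgeProj_d (hM : A.IsMinimal) {p : ℕ} {Φ : Free V}
    (h : Φ ∈ wedge (fun i => (⊤ : Submodule ℚ (V i))) p) :
    ∀ q ≤ p, wedgeProj q (A.d Φ) = 0 := by
  induction h using Submodule.pow_induction_on_left' with
  | algebraMap c =>
    intro q _
    rw [Algebra.algebraMap_eq_smul_one, map_smul, d_one, smul_zero, map_zero]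
  | add x y i hx hy h1 h2 =>
    intro q hq
    rw [map_add, map_add, h1 q hq, h2 q hq, add_zero]
  | mem_mul m hm p x hx ih =>
    intro q hq
    refine Submodule.iSup_induction _ (motive := fun m => wedgeProj q (A.d (m * x)) = 0)
      hm ?_ (by simp) (fun m m' h1 h2 => by rw [add_mul, map_add, map_add, h1, h2, add_zero])
    rintro i _ ⟨v, -, rfl⟩
    have hv : ι i v ∈ wedge (fun i => (⊤ : Submodule ℚ (V i))) 1 := by
      rw [wedge, pow_one]
      exact ι_mem_gens i v
    have hd : ι i v ∈ degPart V i :=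
      Submodule.mem_iSup_of_mem [i] (by simp)
    rw [A.leibniz i _ hd, map_add, map_smul]
    have e1 : wedgeProj q (A.d (ι i v) * x) = 0 := by
      by_cases hqp : p ≤ q
      · obtain ⟨r, rfl⟩ := Nat.exists_eq_add_of_le' hqp
        rw [wedgeProj_mul_right hx, hM.wedgeProj_d_ι i v (by omega), zero_mul]
      · exact wedgeProj_mul_right_lt hx (by omega) _
    have e2 : wedgeProj q (ι i v * A.d x) = 0 := by
      rcases q with _ | r
      · change (wedgeHom (ι i v * A.d x)).coeff 0 = 0
        rw [map_mul, wedgeHom_ι, Polynomial.mul_coeff_zero]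
        simp [Polynomial.coeff_monomial]
      · rw [wedgeProj_mul_left hv, ih r (by omega), mul_zero]
    rw [e1, e2, smul_zero, add_zero]

theorem IsMinimal.wedgeProj_d_eq_sum (hM : A.IsMinimal) (p : ℕ) (Ψ : Free V) :
    wedgeProj p (A.d Ψ) = ∑ a ∈ Finset.range p, wedgeProj p (A.d (wedgeProj a Ψ)) := by
  induction Ψ using wedge_induction with
  | hw b Ψ hb =>
    by_cases h : b < p
    · rw [Finset.sum_eq_single_of_mem b (Finset.mem_range.2 h)]
      · rw [wedgeProj_of_mem hb, if_pos rfl]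
      · intro a _ hab
        rw [wedgeProj_of_mem hb, if_neg hab.symm, map_zero, map_zero]
    · rw [hM.wedgeProj_d hb p (by omega)]
      refine (Finset.sum_eq_zero fun a ha => ?_).symm
      have := Finset.mem_range.1 ha
      rw [wedgeProj_of_mem hb, if_neg (by omega), map_zero, map_zero]
  | ha Ψ Ψ' h1 h2 =>
    simp only [map_add, h1, h2, Finset.sum_add_distrib]

/-- The quadratic algebra `(Λ V, d₁)` associated with a minimal algebra `(Λ V, d)`. -/
def quadratic (A : FreeCDGA V) (hM : A.IsMinimal) : FreeCDGA V where
  d := A.quadD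
  d_mem := A.quadD_mem
  leibniz := A.quadD_leibniz
  d_d Φ := by
    induction Φ using wedge_induction with
    | hw p Φ h =>
      have e := hM.wedgeProj_d_eq_sum (p + 2) (A.d Φ)
      rw [A.d_d, map_zero, Finset.sum_range_succ, Finset.sum_eq_zero, zero_add] at e
      · rw [A.quadD_of_mem h, A.quadD_of_mem (wedgeProj_mem _ _), ← e]
      · intro a ha
        have := Finset.mem_range.1 ha
        rw [hM.wedgeProj_d h a (by omega), map_zero, map_zero]
    | ha Φ Ψ h1 h2 => rw [map_add, map_add, h1, h2, add_zero]

theorem quadratic_isMinimal (hM : A.IsMinimal) : (A.quadratic hM).IsMinimal := by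
  intro i v
  change A.quadD (ι i v) ∈ _
  rw [quadD_ι]
  exact Submodule.mem_iSup_of_mem 2 (Submodule.mem_iSup_of_mem le_rfl (wedgeProj_mem _ _))

/-! ### The homotopy Lie algebra -/

variable (A)

/-- The filtration of `V` determined by `d₁`: `V_0 = V ∩ ker d₁`, `V_{n+1} = V ∩ d₁⁻¹(Λ² V_n)`. -/
def quadFiltration : ℕ → ∀ i, Submodule ℚ (V i)
  | 0, i => (LinearMap.ker A.quadD).comap (ι i)
  | n + 1, i => (wedge (quadFiltration n) 2).comap (A.quadD ∘ₗ ι i)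

variable (V) in
/-- The degree `p` part of the homotopy Lie algebra: `s` identifies it with `(V^{p+1})^∨`. An element
`x` is stored as the functional `s x`. -/
abbrev L (p : ℕ) : Type u := Module.Dual ℚ (V (p + 1))

/-- The Lie bracket, `⟨v, s[x,y]⟩ = (-1)^{deg y + 1} ⟨d₁ v ; sx, sy⟩`. -/
def bracket {p q : ℕ} (x : L V p) (y : L V q) : L V (p + q) :=
  (-1 : ℚ) ^ (q + 1) • (pairing x y ∘ₗ A.quadD ∘ₗ ι (p + q + 1))

/-- `x` is an iterated commutator `[x₁, [x₂, … [x_{r-1}, x_r] … ]]` of length `r` of homogeneous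
elements. -/
inductive IsCommutator : ℕ → ∀ p : ℕ, L V p → Prop
  | single {p : ℕ} (x : L V p) : IsCommutator 1 p x
  | bracket {r p q : ℕ} (x : L V p) (y : L V q) (hy : IsCommutator r q y) :
      IsCommutator (r + 1) (p + q) (A.bracket x y)

/-- The lower central series: `lcs r p` is the degree `p` part of `L^r`, for `r ≥ 1`. -/
def lcs (r p : ℕ) : Submodule ℚ (L V p) := Submodule.span ℚ {x | A.IsCommutator r p x}

/-! ### The finite dimensional subalgebras and the Sullivan lower central series -/

/-- The index set of the finite dimensional graded subspaces `V_α ⊆ V` for which `Λ V_α` is preserved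
by `d`. -/
structure FinSub where
  carrier : ∀ i, Submodule ℚ (V i)
  finite : Module.Finite ℚ (⨁ i, carrier i)
  stable : ∀ Φ ∈ subalg carrier, A.d Φ ∈ subalg carrier

variable {A}

namespace FinSub

variable (α : A.FinSub)

/-- The graded vector space `V_α`. -/
abbrev space (i : ℕ) : Type u := α.carrier i

/-- The inclusion `Λ V_α → Λ V`. -/
def incl : Free α.space →ₐ[ℚ] Free V := map fun i => (α.carrier i).subtype

/-- A retraction `Λ V → Λ V_α`, induced by a linear retraction `V → V_α`. -/
def retr : Free V →ₐ[ℚ] Free α.space :=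
  map fun i => Classical.choose
    (LinearMap.exists_leftInverse_of_injective (α.carrier i).subtype (Submodule.ker_subtype _))

theorem retr_incl (Φ : Free α.space) : α.retr (α.incl Φ) = Φ := by
  have h : α.retr.comp α.incl = AlgHom.id ℚ _ := by
    refine algHom_ext fun i v => ?_
    simp only [retr, incl, AlgHom.comp_apply, map_ι, AlgHom.id_apply]
    congr 1
    exact LinearMap.congr_fun (Classical.choose_spec (LinearMap.exists_leftInverse_of_injective
      (α.carrier i).subtype (Submodule.ker_subtype _))) v
  exact DFunLike.congr_fun h Φ

theorem incl_injective : Function.Injective α.incl :=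
  Function.LeftInverse.injective α.retr_incl

theorem incl_retr_d (Φ : Free α.space) : α.incl (α.retr (A.d (α.incl Φ))) = A.d (α.incl Φ) := by
  have h : α.incl Φ ∈ subalg α.carrier := by
    rw [subalg_eq_range]
    exact ⟨Φ, rfl⟩
  have h' := α.stable _ h
  rw [subalg_eq_range] at h'
  obtain ⟨Ψ, hΨ⟩ := h'
  have hΨ' : α.incl Ψ = A.d (α.incl Φ) := hΨ
  rw [← hΨ', retr_incl]

/-- The algebra `(Λ V_α, d)`, where `d` is the restriction of the differential of `Λ V`. -/
def cdga : FreeCDGA α.space where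
  d := α.retr.toLinearMap ∘ₗ A.d ∘ₗ α.incl.toLinearMap
  d_mem n Φ h := map_degPart _ (A.d_mem n _ (map_degPart _ h))
  leibniz n Φ h Ψ := by
    have h' : α.incl Φ ∈ degPart V n := map_degPart _ h
    simp only [LinearMap.comp_apply, AlgHom.toLinearMap_apply, map_mul, A.leibniz n _ h', map_add,
      map_smul, retr_incl]
  d_d Φ := by
    simp only [LinearMap.comp_apply, AlgHom.toLinearMap_apply, incl_retr_d, A.d_d, map_zero]

theorem incl_d (Φ : Free α.space) : α.incl (α.cdga.d Φ) = A.d (α.incl Φ) :=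
  α.incl_retr_d Φ

/-- The Lie algebra surjection `ρ_α : L_V → L_α`, dual to the inclusion `V_α → V`. -/
def rho (p : ℕ) : L V p →ₗ[ℚ] L α.space p := (α.carrier (p + 1)).dualRestrict

end FinSub

variable (A)

/-- The Sullivan lower central series `L_V^{(r)} = lim_α L_α^r`, as a graded subspace of
`L_V = lim_α L_α`: the degree `p` part consists of the `x` with `ρ_α x ∈ L_α^r` for all `α`. -/
def sullivanLCS (r p : ℕ) : Submodule ℚ (L V p) :=
  ⨅ α : A.FinSub, (α.cdga.lcs r p).comap (α.rho p)

/-! ### Cohomology and the Hurewicz map -/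

/-- The cocycles of degree `n`. -/
def cocycles (n : ℕ) : Submodule ℚ (Free V) := LinearMap.ker A.d ⊓ degPart V n

/-- The cohomology `H^n(Λ V, d)`. -/
abbrev H (n : ℕ) : Type u := A.cocycles n ⧸ (LinearMap.range A.d).submoduleOf (A.cocycles n)

variable {A}

theorem IsMinimal.linPart_d (hM : A.IsMinimal) (Φ : Free V) : linPart (A.d Φ) = 0 := by
  induction Φ using wedge_induction with
  | hw p Φ h =>
    rcases p with _ | p
    · rw [wedge, pow_zero] at h
      obtain ⟨c, rfl⟩ := Submodule.mem_one.1 h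
      rw [Algebra.algebraMap_eq_smul_one, map_smul, d_one, smul_zero, map_zero]
    · rw [← linPart_wedgeProj, hM.wedgeProj_d h 1 (by omega), map_zero]
  | ha Φ Ψ h1 h2 => rw [map_add, map_add, h1, h2, add_zero]

/-- The linear map `ξ : H^n(Λ V, d) → V^n` induced, for `n ≥ 1`, by division by `Λ^{≥ 2} V`. -/
def xi (A : FreeCDGA V) (hM : A.IsMinimal) (n : ℕ) : A.H n →ₗ[ℚ] V n :=
  ((LinearMap.range A.d).submoduleOf (A.cocycles n)).liftQ
    (DirectSum.component ℚ ℕ V n ∘ₗ linPart ∘ₗ (A.cocycles n).subtype) (by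
      rintro ⟨Φ, hΦ⟩ ⟨Ψ, hΨ⟩
      have h : A.d Ψ = Φ := hΨ
      simp [← h, hM.linPart_d])

/-- The Hurewicz map `ξ^∨ : L_V → H(Λ V, d)^∨`, of degree one. -/
def hurewicz (A : FreeCDGA V) (hM : A.IsMinimal) (p : ℕ) :
    L V p →ₗ[ℚ] Module.Dual ℚ (A.H (p + 1)) :=
  (A.xi hM (p + 1)).dualMap

end FreeCDGA

end Sullivan

end

/-! Everything rests on one identity: in degree `p`, `L_V^{(n+2)}` is the annihilator of `V_n^{p+1}`
(`IsSullivan.sullivanLCS_eq`). For any subspace `S` of a vector space `E` over a field, `E^∨ / S^⊥ ≅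
S^∨` and `S^⊥ ≅ (E/S)^∨`, so (a) and (b) follow without any finiteness assumption on `V`.

When `V` is finite dimensional in each degree, the identity `L^{n+2} = V_n^⊥` is proved by induction
(`lcs_succ_eq`). If `L^{r+1} = S^⊥`, then `v` is killed by all brackets `[x, y]` with `y ∈ L^{r+1}`
iff `⟨d₁v ; f, g⟩ = 0` for all `f` and all `g ∈ S^⊥`. This says exactly that `d₁v ∈ Λ²S`, which is
the condition defining the next step of the filtration; double annihilators finish the step. The
substantial direction, from vanishing pairings to membership in `Λ²S`, uses characteristic zero: a
projection `P` with kernel `S` extends to a derivation `θ` built from contractions with functionals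
in `S^⊥`, and on `Λ²V` the map induced by `1 - P` is `(θ - 1)(θ - 2)/2`. If all those contractions
kill `Φ`, then `Φ` equals its image in `Λ²S`.

The general case follows by passing to the limit. The Sullivan condition makes `V` the union of the
`V_α` (`IsSullivan.exists_finSub_mem`), and `(V_α)_n = V_α ∩ V_n` (`FinSub.quadFiltration_cdga`)
because `Λ²T ∩ ΛU = Λ²(T ∩ U)`.

For (c), the linear part of a `d`-cocycle lies in `V_0`, so `ξ^∨` kills `V_0^⊥ = L_V^{(2)}`; for
`d₁`, every element of `V_0` is itself a cocycle, so `ξ` maps onto `V_0`. -/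

noncomputable section

namespace Sullivan

universe u

/-! ### Quadratic elements and their pairing with functionals -/

section Quadratic

variable {V : ℕ → Type u} [∀ i, AddCommGroup (V i)] [∀ i, Module ℚ (V i)]

variable (V) in
/-- The degree `m` part of `Λ² V`. -/
def quadPart (m : ℕ) : Submodule ℚ (Free V) :=
  ⨆ (i : ℕ) (j : ℕ) (_ : i + j = m), LinearMap.range (ι (V := V) i) * LinearMap.range (ι (V := V) j)

theorem quadPart_induction {m : ℕ} {C : Free V → Prop}
    (hι : ∀ i j, i + j = m → ∀ (v : V i) (w : V j), C (ι i v * ι j w))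
    (ha : ∀ Φ Ψ, C Φ → C Ψ → C (Φ + Ψ)) {Φ : Free V} (h : Φ ∈ quadPart V m) : C Φ := by
  have h0 : C 0 := by simpa using hι 0 m (zero_add m) 0 0
  refine Submodule.iSup_induction _ (motive := C) h (fun i Ψ hΨ => ?_) h0 ha
  refine Submodule.iSup_induction _ (motive := C) hΨ (fun j Ψ hΨ => ?_) h0 ha
  by_cases hij : i + j = m
  · simp only [hij, iSup_pos] at hΨ
    refine Submodule.mul_induction_on hΨ ?_ ha
    rintro _ ⟨v, rfl⟩ _ ⟨w, rfl⟩
    exact hι i j hij v w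
  · simp only [hij, not_false_eq_true, iSup_neg, Submodule.mem_bot] at hΨ
    exact hΨ ▸ h0

theorem degPart_list_induction {n : ℕ} {C : Free V → Prop}
    (hl : ∀ l : List ℕ, l.sum = n →
      ∀ Φ ∈ (l.map fun i => LinearMap.range (ι (V := V) i)).prod, C Φ)
    (h0 : C 0) (ha : ∀ Φ Ψ, C Φ → C Ψ → C (Φ + Ψ)) {Φ : Free V} (h : Φ ∈ degPart V n) : C Φ := by
  refine Submodule.iSup_induction _ (motive := C) h (fun l Ψ hΨ => ?_) h0 ha
  by_cases hln : l.sum = n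
  · simp only [hln, iSup_pos] at hΨ
    exact hl l hln Ψ hΨ
  · simp only [hln, not_false_eq_true, iSup_neg, Submodule.mem_bot] at hΨ
    exact hΨ ▸ h0

theorem wedgeProj_two_mem_quadPart {m : ℕ} {Φ : Free V} (h : Φ ∈ degPart V m) :
    wedgeProj 2 Φ ∈ quadPart V m := by
  refine degPart_list_induction (C := fun Φ => wedgeProj 2 Φ ∈ quadPart V m)
    (fun l hl Φ hΦ => ?_) (by simp) (fun Φ Ψ h1 h2 => by rw [map_add]; exact add_mem h1 h2) h
  rw [wedgeProj_of_mem (prod_le_wedge l hΦ)]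
  split_ifs with hlen
  · obtain ⟨i, j, rfl⟩ := List.length_eq_two.1 hlen
    refine Submodule.mem_iSup_of_mem i (Submodule.mem_iSup_of_mem j
      (Submodule.mem_iSup_of_mem (by simpa using hl) ?_))
    simpa using hΦ
  · exact zero_mem _

/-- In total degree `n`, the only products of wedge degree one are generators of degree `n`, so no
other component of `linPart` contributes. -/
theorem wedgeProj_one_eq {n : ℕ} {Φ : Free V} (h : Φ ∈ degPart V n) :
    wedgeProj 1 Φ = ι n (DirectSum.component ℚ ℕ V n (linPart Φ)) := by
  refine degPart_list_induction
    (C := fun Φ => wedgeProj 1 Φ = ι n (DirectSum.component ℚ ℕ V n (linPart Φ)))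
    (fun l hl Φ hΦ => ?_) (by simp) (fun Φ Ψ h1 h2 => by simp only [map_add, h1, h2]) h
  have hw := prod_le_wedge l hΦ
  by_cases hlen : l.length = 1
  · obtain ⟨i, rfl⟩ := List.length_eq_one_iff.1 hlen
    obtain rfl : i = n := by simpa using hl
    obtain ⟨v, rfl⟩ : Φ ∈ LinearMap.range (ι (V := V) i) := by simpa using hΦ
    rw [wedgeProj_of_mem hw, if_pos hlen, linPart_ι, DirectSum.component.lof_self]
  · rw [wedgeProj_of_mem hw, if_neg hlen, linPart_wedge hlen hw, map_zero, map_zero]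

theorem wedge_induction_of_mem {S : ∀ i, Submodule ℚ (V i)} {C : Free V → Prop}
    (hι : ∀ i j, ∀ v ∈ S i, ∀ w ∈ S j, C (ι i v * ι j w))
    (ha : ∀ Φ Ψ, C Φ → C Ψ → C (Φ + Ψ)) {Φ : Free V} (h : Φ ∈ wedge S 2) : C Φ := by
  have h0 : C 0 := by simpa using hι 0 0 0 (zero_mem _) 0 (zero_mem _)
  rw [wedge, pow_two] at h
  refine Submodule.mul_induction_on h (fun x hx y hy => ?_) ha
  refine Submodule.iSup_induction _ (motive := fun x => C (x * y)) hx ?_ (by simpa using h0)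
    (fun a b h1 h2 => by rw [add_mul]; exact ha _ _ h1 h2)
  rintro i _ ⟨v, hv, rfl⟩
  refine Submodule.iSup_induction _ (motive := fun y => C (ι i v * y)) hy ?_ (by simpa using h0)
    (fun a b h1 h2 => by rw [mul_add]; exact ha _ _ h1 h2)
  rintro j _ ⟨w, hw, rfl⟩
  exact hι i j v hv w hw

theorem ι_mem_gens_of_mem {S : ∀ i, Submodule ℚ (V i)} {i : ℕ} {v : V i} (h : v ∈ S i) :
    ι i v ∈ gens S :=
  Submodule.mem_iSup_of_mem i ⟨v, h, rfl⟩

theorem ι_mul_ι_mem_wedge {S : ∀ i, Submodule ℚ (V i)} {i j : ℕ} {v : V i} {w : V j}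
    (hv : v ∈ S i) (hw : w ∈ S j) : ι i v * ι j w ∈ wedge S 2 := by
  rw [wedge, pow_two]
  exact Submodule.mul_mem_mul (ι_mem_gens_of_mem hv) (ι_mem_gens_of_mem hw)

/-- Each of the two terms of `⟨vw ; f, g⟩` evaluates `g` on `v` or on `w`, so it suffices that the
second functional vanishes on `S`. -/
theorem pairing_eq_zero_of_mem_wedge {S : ∀ i, Submodule ℚ (V i)} {a b : ℕ}
    (f : Module.Dual ℚ (V a)) {g : Module.Dual ℚ (V b)} (hg : g ∈ (S b).dualAnnihilator)
    {Φ : Free V} (h : Φ ∈ wedge S 2) : pairing f g Φ = 0 := by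
  have hz : ∀ i, ∀ v ∈ S i, extend b g i v = 0 := by
    intro i v hv
    by_cases hi : i = b
    · subst hi
      rw [extend_self]
      exact (Submodule.mem_dualAnnihilator _).1 hg v hv
    · exact extend_of_ne hi g v
  refine wedge_induction_of_mem (C := fun Φ => pairing f g Φ = 0) (fun i j v hv w hw => ?_)
    (fun Φ Ψ h1 h2 => by rw [map_add, h1, h2, add_zero]) h
  rw [pairing_ι_mul_ι, hz i v hv, hz j w hw]
  simp

theorem extend_add (a : ℕ) (f g : Module.Dual ℚ (V a)) (i : ℕ) (v : V i) :
    extend a (f + g) i v = extend a f i v + extend a g i v := rfl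

theorem extend_smul (a : ℕ) (c : ℚ) (f : Module.Dual ℚ (V a)) (i : ℕ) (v : V i) :
    extend a (c • f) i v = c * extend a f i v := rfl

theorem extend_zero (a i : ℕ) (v : V i) : extend a (0 : Module.Dual ℚ (V a)) i v = 0 := rfl

/-- If the functional `f` is fixed, then `⟨Φ ; f, g⟩` vanishes for `g` in the span of a set on which
it vanishes. -/
theorem pairing_eq_zero_of_mem_span {a b m : ℕ} (f : Module.Dual ℚ (V a))
    {s : Set (Module.Dual ℚ (V b))} {Φ : Free V} (hΦ : Φ ∈ quadPart V m)
    (h : ∀ g ∈ s, pairing f g Φ = 0) {g : Module.Dual ℚ (V b)} (hg : g ∈ Submodule.span ℚ s) :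
    pairing f g Φ = 0 := by
  induction hg using Submodule.span_induction with
  | mem g hg => exact h g hg
  | zero =>
    refine quadPart_induction (C := fun Φ => pairing f (0 : Module.Dual ℚ (V b)) Φ = 0)
      (fun i j _ v w => ?_) (fun Φ Ψ h1 h2 => by rw [map_add, h1, h2, add_zero]) hΦ
    simp [pairing_ι_mul_ι, extend_zero]
  | add g g' _ _ h1 h2 =>
    -- Linearity in `g` is not built into `contract`, which comes from an algebra morphism depending
    -- on `g`; it is checked on products of two generators.
    have : pairing f (g + g') Φ = pairing f g Φ + pairing f g' Φ := by
      refine quadPart_induction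
        (C := fun Φ => pairing f (g + g') Φ = pairing f g Φ + pairing f g' Φ)
        (fun i j _ v w => ?_) (fun Φ Ψ h1 h2 => ?_) hΦ
      · simp only [pairing_ι_mul_ι, extend_add]
        ring
      · rw [map_add, map_add, map_add, h1, h2]
        ring
    rw [this, h1, h2, add_zero]
  | smul c g _ h1 =>
    have : pairing f (c • g) Φ = c * pairing f g Φ := by
      refine quadPart_induction (C := fun Φ => pairing f (c • g) Φ = c * pairing f g Φ)
        (fun i j _ v w => ?_) (fun Φ Ψ h1 h2 => ?_) hΦ
      · simp only [pairing_ι_mul_ι, extend_smul]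
        ring
      · rw [map_add, map_add, h1, h2]
        ring
    rw [this, h1, mul_zero]

theorem contract_ι_mul_ι (b : ℕ) (g : Module.Dual ℚ (V b)) {i j : ℕ} (v : V i) (w : V j) :
    contract b g (ι i v * ι j w) =
      extend b g i v • ι j w + ((-1 : ℚ) ^ (b * i) * extend b g j w) • ι i v := by
  rw [contract_ι_mul, contract_ι, ← Algebra.commutes, ← Algebra.smul_def, smul_smul]

theorem contract_mem_range {a b : ℕ} (g : Module.Dual ℚ (V b)) {Φ : Free V}
    (h : Φ ∈ quadPart V (a + b)) : contract b g Φ ∈ LinearMap.range (ι (V := V) a) := by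
  refine quadPart_induction (C := fun Φ => contract b g Φ ∈ LinearMap.range (ι (V := V) a))
    (fun i j hij v w => ?_) (fun Φ Ψ h1 h2 => by rw [map_add]; exact add_mem h1 h2) h
  rw [contract_ι_mul_ι]
  refine add_mem ?_ ?_
  · by_cases hi : i = b
    · obtain rfl : j = a := by omega
      exact Submodule.smul_mem _ _ ⟨w, rfl⟩
    · rw [extend_of_ne hi, zero_smul]
      exact zero_mem _
  · by_cases hj : j = b
    · obtain rfl : i = a := by omega
      exact Submodule.smul_mem _ _ ⟨v, rfl⟩
    · rw [extend_of_ne hj, mul_zero, zero_smul]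
      exact zero_mem _

/-- Contracting a quadratic element with `g` leaves a generator `u` of degree `a`, the pairing with
`f` is then `f u`, and functionals separate vectors. -/
theorem contract_eq_zero {a b : ℕ} {g : Module.Dual ℚ (V b)} {Φ : Free V}
    (h : Φ ∈ quadPart V (a + b)) (hp : ∀ f : Module.Dual ℚ (V a), pairing f g Φ = 0) :
    contract b g Φ = 0 := by
  obtain ⟨u, hu⟩ := contract_mem_range g h
  have hu0 : u = 0 := by
    rw [← Module.forall_dual_apply_eq_zero_iff ℚ]
    intro f
    have := hp f
    rw [pairing, LinearMap.comp_apply, LinearMap.comp_apply, ← hu, contract_ι,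
      AlgHom.toLinearMap_apply, AlgHom.commutes, extend_self] at this
    exact this
  rw [← hu, hu0, map_zero]

/-! ### Detecting `Λ² S` by contractions -/

section Euler

variable [∀ i, Module.Finite ℚ (V i)]

/-- On the part of degree at most `m`, the derivation that extends the degree zero linear map `P`,
written in terms of contractions. -/
def eulerDer (P : ∀ i, V i →ₗ[ℚ] V i) (m : ℕ) (Φ : Free V) : Free V :=
  ∑ a ∈ Finset.range (m + 1), ∑ k, ι a (Module.finBasis ℚ (V a) k) *
    contract a ((Module.finBasis ℚ (V a)).coord k ∘ₗ P a) Φ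

theorem eulerDer_add (P : ∀ i, V i →ₗ[ℚ] V i) (m : ℕ) (Φ Ψ : Free V) :
    eulerDer P m (Φ + Ψ) = eulerDer P m Φ + eulerDer P m Ψ := by
  simp only [eulerDer, map_add, mul_add, Finset.sum_add_distrib]

/-- This is the expansion of `P v` in the chosen basis; only the summand in the degree of `v`
survives. -/
theorem sum_extend_smul_ι (P : ∀ i, V i →ₗ[ℚ] V i) (a i : ℕ) (v : V i) :
    ∑ k, extend a ((Module.finBasis ℚ (V a)).coord k ∘ₗ P a) i v •
      ι a (Module.finBasis ℚ (V a) k) = if a = i then ι i (P i v) else 0 := by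
  split_ifs with h
  · subst h
    simp only [extend_self, ← map_smul]
    rw [← map_sum]
    congr 1
    exact (Module.finBasis ℚ (V a)).sum_repr (P a v)
  · exact Finset.sum_eq_zero fun k _ => by rw [extend_of_ne (Ne.symm h), zero_smul]

theorem eulerDer_ι_mul_ι (P : ∀ i, V i →ₗ[ℚ] V i) {m i j : ℕ} (hij : i + j = m)
    (v : V i) (w : V j) :
    eulerDer P m (ι i v * ι j w) = ι i (P i v) * ι j w + ι i v * ι j (P j w) := by
  have key : ∀ a, ∑ k, ι a (Module.finBasis ℚ (V a) k) *
      contract a ((Module.finBasis ℚ (V a)).coord k ∘ₗ P a) (ι i v * ι j w) =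
      (if a = i then ι i (P i v) * ι j w else 0) + if a = j then ι i v * ι j (P j w) else 0 := by
    intro a
    have h1 := congrArg (· * ι j w) (sum_extend_smul_ι P a i v)
    have h2 := congrArg (fun Φ => (-1 : ℚ) ^ (a * i) • (Φ * ι i v)) (sum_extend_smul_ι P a j w)
    simp only [Finset.sum_mul, Finset.smul_sum, smul_mul_assoc, ite_mul, zero_mul] at h1 h2
    rw [← h1]
    -- The sign from moving the contraction past `v` cancels the sign from moving the new factor `P
    -- w` back behind `v`.
    have h3 : (if a = j then ι i v * ι j (P j w) else 0) =
        (-1 : ℚ) ^ (a * i) • if a = j then ι j (P j w) * ι i v else 0 := by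
      split_ifs with h
      · subst h
        rw [ι_mul_ι, mul_comm i a]
      · rw [smul_zero]
    rw [h3, ← h2, ← Finset.sum_add_distrib]
    refine Finset.sum_congr rfl fun k _ => ?_
    rw [contract_ι_mul_ι, mul_add, mul_smul_comm, mul_smul_comm, mul_smul]
  simp only [eulerDer, key, Finset.sum_add_distrib]
  -- Both `i` and `j` are at most `m = i + j`, so the truncated sum over degrees meets both factors.
  rw [Finset.sum_ite_eq', Finset.sum_ite_eq', if_pos (by simp; omega), if_pos (by simp; omega)]

/-- For the derivation `θ` extending the projection `P`, a product of two vectors from `im P` and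
`ker P` has as eigenvalue the number 0, 1 or 2 of its factors in `im P`. The map induced by `Q = 1 -
P` projects onto the eigenvalue 0, hence equals `(θ - 1)(θ - 2)/2`; the factor 2 is cleared. -/
theorem two_nsmul_map_eq {P Q : ∀ i, V i →ₗ[ℚ] V i} (hQ : ∀ i v, Q i v = v - P i v)
    (hP : ∀ i v, P i (P i v) = P i v) {m : ℕ} {Φ : Free V} (h : Φ ∈ quadPart V m) :
    2 • map Q Φ = 2 • Φ + eulerDer P m (eulerDer P m Φ) - 3 • eulerDer P m Φ := by
  refine quadPart_induction
    (C := fun Φ => 2 • map Q Φ = 2 • Φ + eulerDer P m (eulerDer P m Φ) - 3 • eulerDer P m Φ)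
    (fun i j hij v w => ?_) (fun Φ Ψ h1 h2 => ?_) h
  · simp only [map_mul, map_ι, eulerDer_ι_mul_ι P hij, eulerDer_add, hP, hQ, map_sub, mul_sub,
      sub_mul]
    abel
  · simp only [map_add, eulerDer_add, smul_add, h1, h2]
    abel

/-- An element of `Λ² V` that is annihilated by all contractions with functionals that vanish on `S`
lies in `Λ² S`. -/
theorem mem_wedge_of_contract_eq_zero {S : ∀ i, Submodule ℚ (V i)} {m : ℕ} {Φ : Free V}
    (h : Φ ∈ quadPart V m)
    (hc : ∀ b ≤ m, ∀ g ∈ (S b).dualAnnihilator, contract b g Φ = 0) : Φ ∈ wedge S 2 := by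
  choose π hπ using fun i => (S i).subtype.exists_leftInverse_of_injective (Submodule.ker_subtype _)
  have hπS : ∀ i (s : S i), π i s = s := fun i s => LinearMap.congr_fun (hπ i) s
  let Q : ∀ i, V i →ₗ[ℚ] V i := fun i => (S i).subtype ∘ₗ π i
  let P : ∀ i, V i →ₗ[ℚ] V i := fun i => LinearMap.id - Q i
  have hQS : ∀ i v, Q i v ∈ S i := fun i v => (π i v).2
  have hSQ : ∀ i, ∀ v ∈ S i, Q i v = v := fun i v hv => congrArg Subtype.val (hπS i ⟨v, hv⟩)
  have hQ : ∀ i v, Q i v = v - P i v := fun i v => (sub_sub_cancel v (Q i v)).symm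
  have hPS : ∀ i, ∀ v ∈ S i, P i v = 0 := fun i v hv => by
    change v - Q i v = 0
    rw [hSQ i v hv, sub_self]
  have hP : ∀ i v, P i (P i v) = P i v := fun i v => by
    change P i v - Q i (v - Q i v) = P i v
    rw [map_sub, hSQ i _ (hQS i v), sub_self, sub_zero]
  -- The functionals occurring in `eulerDer` are coordinates of `P`, and `P` vanishes on `S`.
  have h0 : eulerDer P m Φ = 0 := by
    refine Finset.sum_eq_zero fun a ha => Finset.sum_eq_zero fun k _ => ?_
    rw [hc a (Finset.mem_range_succ_iff.1 ha), mul_zero]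
    rw [Submodule.mem_dualAnnihilator]
    intro s hs
    rw [LinearMap.comp_apply, hPS a s hs, map_zero]
  have h00 : eulerDer P m 0 = 0 := by simp [eulerDer]
  have h1 := two_nsmul_map_eq hQ hP h
  rw [h0, h00, smul_zero, add_zero, sub_zero] at h1
  have h2 : Φ = map Q Φ := by
    have := congrArg ((2 : ℚ)⁻¹ • ·) h1
    simp only [← Nat.cast_smul_eq_nsmul ℚ, smul_smul] at this
    norm_num at this
    exact this.symm
  rw [h2]
  refine quadPart_induction (C := fun Φ => map Q Φ ∈ wedge S 2) (fun i j _ v w => ?_)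
    (fun Φ Ψ h1 h2 => by rw [map_add]; exact add_mem h1 h2) h
  rw [map_mul, map_ι, map_ι]
  exact ι_mul_ι_mem_wedge (hQS i v) (hQS j w)

theorem mem_wedge_two_of_pairing_eq_zero {S : ∀ i, Submodule ℚ (V i)} {m : ℕ} {Φ : Free V}
    (h : Φ ∈ quadPart V m)
    (hp : ∀ a b, a + b = m → ∀ (f : Module.Dual ℚ (V a)), ∀ g ∈ (S b).dualAnnihilator,
      pairing f g Φ = 0) : Φ ∈ wedge S 2 := by
  refine mem_wedge_of_contract_eq_zero h fun b hb g hg => ?_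
  obtain ⟨a, rfl⟩ := Nat.exists_eq_add_of_le' hb
  exact contract_eq_zero h fun f => hp a b rfl f g hg

end Euler

/-! ### Functoriality and `Λ² T ∩ Λ U` -/

section Map

variable {W : ℕ → Type u} [∀ i, AddCommGroup (W i)] [∀ i, Module ℚ (W i)]

theorem map_wedgeProj (f : ∀ i, V i →ₗ[ℚ] W i) (p : ℕ) (Φ : Free V) :
    map f (wedgeProj p Φ) = wedgeProj p (map f Φ) := by
  have hg : (gens fun i => (⊤ : Submodule ℚ (V i))).map (map f).toLinearMap ≤
      gens fun i => (⊤ : Submodule ℚ (W i)) := by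
    rw [gens, Submodule.map_iSup]
    refine iSup_le fun i => ?_
    rintro _ ⟨_, ⟨v, -, rfl⟩, rfl⟩
    rw [AlgHom.toLinearMap_apply, map_ι]
    exact ι_mem_gens i _
  induction Φ using wedge_induction with
  | hw q Φ h =>
    have h' : map f Φ ∈ wedge (fun i => (⊤ : Submodule ℚ (W i))) q := by
      refine pow_le_pow_left' hg q ?_
      rw [← Submodule.map_pow]
      exact ⟨Φ, h, rfl⟩
    rw [wedgeProj_of_mem h, wedgeProj_of_mem h']
    split_ifs
    · rfl
    · exact map_zero _
  | ha Φ Ψ h1 h2 => simp only [map_add, h1, h2]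

theorem map_mem_wedge_two {f : ∀ i, V i →ₗ[ℚ] W i} {S : ∀ i, Submodule ℚ (V i)}
    {T : ∀ i, Submodule ℚ (W i)} (hf : ∀ i, ∀ v ∈ S i, f i v ∈ T i) {Φ : Free V}
    (h : Φ ∈ wedge S 2) : map f Φ ∈ wedge T 2 := by
  refine wedge_induction_of_mem (C := fun Φ => map f Φ ∈ wedge T 2) (fun i j v hv w hw => ?_)
    (fun Φ Ψ h1 h2 => by rw [map_add]; exact add_mem h1 h2) h
  rw [map_mul, map_ι, map_ι]
  exact ι_mul_ι_mem_wedge (hf i v hv) (hf j w hw)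

theorem map_map {X : ℕ → Type u} [∀ i, AddCommGroup (X i)] [∀ i, Module ℚ (X i)]
    (g : ∀ i, W i →ₗ[ℚ] X i) (f : ∀ i, V i →ₗ[ℚ] W i) (Φ : Free V) :
    map g (map f Φ) = map (fun i => g i ∘ₗ f i) Φ := by
  have h : (map g).comp (map f) = map fun i => g i ∘ₗ f i :=
    algHom_ext fun i v => by simp [map_ι]
  exact DFunLike.congr_fun h Φ

theorem map_id_apply (Φ : Free V) : map (fun i => (LinearMap.id : V i →ₗ[ℚ] V i)) Φ = Φ := by
  have h : map (fun i => (LinearMap.id : V i →ₗ[ℚ] V i)) = AlgHom.id ℚ _ :=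
    algHom_ext fun i v => by simp [map_ι]
  exact DFunLike.congr_fun h Φ

/-- A subspace has a linear retraction that maps a second subspace into itself. -/
theorem exists_retraction_mapsTo {E : Type*} [AddCommGroup E] [Module ℚ E]
    (U T : Submodule ℚ E) :
    ∃ r : E →ₗ[ℚ] U, (∀ u : U, r u = u) ∧ ∀ t ∈ T, (r t : E) ∈ T := by
  -- A complement `W` of `U ∩ T` in `T` is disjoint from `U`, so it extends to a complement `W'` of
  -- `U`. The projection onto `U` along `W'` sends `T = (U ∩ T) ⊕ W` onto `U ∩ T`.
  obtain ⟨W, hW⟩ := exists_isCompl ((U ⊓ T).submoduleOf T)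
  have hUW : Disjoint U (W.map T.subtype) := by
    rw [Submodule.disjoint_def]
    rintro _ hxU ⟨x, hx, rfl⟩
    have : x = 0 := Submodule.disjoint_def.1 hW.disjoint x ⟨hxU, x.2⟩ hx
    rw [this, map_zero]
  obtain ⟨W', hWW', hW'⟩ := hUW.symm.exists_isCompl
  refine ⟨Submodule.projectionOnto U W' hW'.symm, Submodule.projectionOnto_apply_left _,
    fun t ht => ?_⟩
  obtain ⟨a, ha, w, hw, haw⟩ := Submodule.mem_sup.1
    (show (⟨t, ht⟩ : T) ∈ _ ⊔ W from hW.sup_eq_top ▸ Submodule.mem_top)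
  obtain rfl : (a : E) + w = t := congrArg Subtype.val haw
  have h1 := Submodule.projectionOnto_apply_left hW'.symm ⟨a, ha.1⟩
  have h2 := Submodule.projectionOnto_apply_right hW'.symm ⟨w, hWW' ⟨w, hw, rfl⟩⟩
  simp only at h1 h2
  rw [map_add, h1, h2, add_zero]
  exact a.2

/-- `Λ² T ∩ Λ U = Λ² (T ∩ U)`. -/
theorem map_subtype_mem_wedge_two {U T : ∀ i, Submodule ℚ (V i)} {Φ : Free fun i => U i} :
    map (fun i => (U i).subtype) Φ ∈ wedge T 2 ↔
      Φ ∈ wedge (fun i => (T i).comap (U i).subtype) 2 := by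
  constructor
  · intro h
    -- A retraction of `V` onto `U` that preserves `T` carries an expression in `Λ² T` to one in `Λ²
    -- (T ∩ U)` and fixes `Φ`.
    choose r hr hrT using fun i => exists_retraction_mapsTo (U i) (T i)
    have h1 := map_mem_wedge_two (f := r) (T := fun i => (T i).comap (U i).subtype) hrT h
    have h2 : (fun i => r i ∘ₗ (U i).subtype) = fun i => LinearMap.id :=
      funext fun i => LinearMap.ext (hr i)
    rwa [map_map, h2, map_id_apply] at h1
  · exact map_mem_wedge_two fun i v hv => hv

end Map

end Quadratic

theorem ι_mem_degPart {V : ℕ → Type u} [∀ i, AddCommGroup (V i)] [∀ i, Module ℚ (V i)]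
    (i : ℕ) (v : V i) : ι i v ∈ degPart V i :=
  Submodule.mem_iSup_of_mem [i] (by simp)

theorem subalg_mono {V : ℕ → Type u} [∀ i, AddCommGroup (V i)] [∀ i, Module ℚ (V i)]
    {S T : ∀ i, Submodule ℚ (V i)} (h : ∀ i, S i ≤ T i) : subalg S ≤ subalg T :=
  Algebra.adjoin_mono (iSup_mono fun i => Submodule.map_mono (h i))

namespace FreeCDGA

variable {V : ℕ → Type u} [∀ i, AddCommGroup (V i)] [∀ i, Module ℚ (V i)]

/-! ### The lower central series in finite type -/

section LowerCentralSeries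

variable (A : FreeCDGA V)

theorem quadD_ι_mem_quadPart (i : ℕ) (v : V i) : A.quadD (ι i v) ∈ quadPart V (i + 1) := by
  rw [quadD_ι]
  exact wedgeProj_two_mem_quadPart (A.d_mem i _ (ι_mem_degPart i v))

theorem lcs_one (p : ℕ) : A.lcs 1 p = ⊤ :=
  eq_top_iff.2 fun x _ => Submodule.subset_span (IsCommutator.single x)

variable {A} in
theorem IsCommutator.apply_eq_zero {S : ∀ i, Submodule ℚ (V i)} {r : ℕ}
    (hS : ∀ q, A.lcs (r + 1) q ≤ (S (q + 1)).dualAnnihilator) {p : ℕ} {x : L V p}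
    (hx : A.IsCommutator (r + 2) p x) {v : V (p + 1)}
    (hv : A.quadD (ι (p + 1) v) ∈ wedge S 2) : x v = 0 := by
  cases hx with
  | bracket x y hy =>
    have := pairing_eq_zero_of_mem_wedge x (hS _ (Submodule.subset_span hy)) hv
    simp [FreeCDGA.bracket, this]

/-- Up to sign, brackets with elements of `S^⊥` evaluated at `v` are the pairings of `d₁v` with
functionals `f` and `g ∈ S^⊥`. They all vanish exactly when `d₁v ∈ Λ²S`. -/
theorem lcs_succ_eq [∀ i, Module.Finite ℚ (V i)] (h0 : Subsingleton (V 0)) {r : ℕ}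
    {S : ∀ i, Submodule ℚ (V i)} (hS : ∀ q, A.lcs (r + 1) q = (S (q + 1)).dualAnnihilator) (p : ℕ) :
    A.lcs (r + 2) p =
      ((wedge S 2).comap (A.quadD ∘ₗ ι (p + 1))).dualAnnihilator := by
  -- In finite dimension a subspace of the dual is determined by its common kernel, so only the
  -- vectors killed by `L^{r+2}` need to be identified.
  rw [← Subspace.dualCoannihilator_dualAnnihilator_eq (W := A.lcs (r + 2) p)]
  congr 1
  ext v
  rw [Submodule.mem_dualCoannihilator, Submodule.mem_comap, LinearMap.comp_apply]
  constructor
  · intro h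
    refine mem_wedge_two_of_pairing_eq_zero (A.quadD_ι_mem_quadPart _ v) fun a b hab f g hg => ?_
    -- Elements of `L` are functionals in degree at least one; functionals in degree zero are
    -- harmless since `V⁰ = 0`.
    rcases a with _ | a
    · obtain rfl : f = 0 := LinearMap.ext fun w => by
        rw [Subsingleton.elim w 0, map_zero, map_zero]
      refine quadPart_induction (C := fun Φ => pairing (0 : Module.Dual ℚ (V 0)) g Φ = 0)
        (fun i j _ v w => ?_) (fun Φ Ψ h1 h2 => by rw [map_add, h1, h2, add_zero])
        (A.quadD_ι_mem_quadPart _ v)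
      simp [pairing_ι_mul_ι, extend_zero]
    rcases b with _ | b
    · obtain rfl : g = 0 := LinearMap.ext fun w => by
        rw [Subsingleton.elim w 0, map_zero, map_zero]
      exact pairing_eq_zero_of_mem_span f (s := ∅) (A.quadD_ι_mem_quadPart _ v) (by simp)
        (zero_mem _)
    obtain rfl : p = a + b := by omega
    rw [← hS b] at hg
    refine pairing_eq_zero_of_mem_span f (A.quadD_ι_mem_quadPart _ v) (fun y hy => ?_) hg
    have h1 := h _ (Submodule.subset_span (IsCommutator.bracket f y hy))
    simpa [FreeCDGA.bracket] using h1
  · intro hv x hx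
    induction hx using Submodule.span_induction with
    | mem x hx => exact hx.apply_eq_zero (fun q => (hS q).le) hv
    | zero => rfl
    | add x y _ _ h1 h2 => rw [LinearMap.add_apply, h1, h2, add_zero]
    | smul c x _ h1 => rw [LinearMap.smul_apply, h1, smul_zero]

theorem lcs_eq_dualAnnihilator [∀ i, Module.Finite ℚ (V i)] (h0 : Subsingleton (V 0)) (n p : ℕ) :
    A.lcs (n + 2) p = (A.quadFiltration n (p + 1)).dualAnnihilator := by
  induction n generalizing p with
  | zero =>
    -- The induction starts at `L^1 = L = 0^⊥`; since `Λ²0 = 0`, the preimage under `d₁` is `ker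
    -- d₁`.
    rw [A.lcs_succ_eq h0 (S := fun _ => ⊥)
      (fun q => by rw [lcs_one, Submodule.dualAnnihilator_bot])]
    have : wedge (fun i => (⊥ : Submodule ℚ (V i))) 2 = ⊥ := by
      simp [wedge, gens, pow_two]
    rw [this]
    rfl
  | succ n ih => exact A.lcs_succ_eq h0 ih p

end LowerCentralSeries

/-! ### Finite dimensional subalgebras and passage to the limit -/

section FinSub

variable {A : FreeCDGA V}

theorem d_mem_subalg {S : ∀ i, Submodule ℚ (V i)} (h : ∀ i, ∀ v ∈ S i, A.d (ι i v) ∈ subalg S) :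
    ∀ Φ ∈ subalg S, A.d Φ ∈ subalg S := by
  -- The Leibniz rule needs a homogeneous left factor. Carrying an arbitrary right factor `Ψ`
  -- through the induction means that it is applied only to generators.
  have key : ∀ Φ ∈ subalg S, ∀ Ψ ∈ subalg S, A.d Ψ ∈ subalg S → A.d (Φ * Ψ) ∈ subalg S := by
    intro Φ hΦ
    refine Algebra.adjoin_induction
      (p := fun Φ _ => ∀ Ψ ∈ subalg S, A.d Ψ ∈ subalg S → A.d (Φ * Ψ) ∈ subalg S)
      (fun Φ hΦ Ψ hΨ hdΨ => ?_) (fun c Ψ hΨ hdΨ => ?_) (fun Φ Φ' _ _ h1 h2 Ψ hΨ hdΨ => ?_)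
      (fun Φ Φ' _ hΦ' h1 h2 Ψ hΨ hdΨ => ?_) hΦ
    · refine Submodule.iSup_induction _ (motive := fun Φ => A.d (Φ * Ψ) ∈ subalg S) hΦ ?_
        (by rw [zero_mul, map_zero]; exact zero_mem _)
        (fun a b h1 h2 => by rw [add_mul, map_add]; exact add_mem h1 h2)
      rintro i _ ⟨v, hv, rfl⟩
      rw [A.leibniz i _ (ι_mem_degPart i v)]
      exact add_mem (mul_mem (h i v hv) hΨ)
        (Subalgebra.smul_mem _ (mul_mem (Algebra.subset_adjoin (ι_mem_gens_of_mem hv)) hdΨ) _)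
    · rw [← Algebra.smul_def, map_smul]
      exact Subalgebra.smul_mem _ hdΨ c
    · rw [add_mul, map_add]
      exact add_mem (h1 Ψ hΨ hdΨ) (h2 Ψ hΨ hdΨ)
    · rw [mul_assoc]
      exact h1 _ (mul_mem hΦ' hΨ) (h2 Ψ hΨ hdΨ)
  intro Φ hΦ
  simpa using key Φ hΦ 1 (one_mem _) (by rw [d_one]; exact zero_mem _)

theorem finite_directSum_of_lof_mem {S : ∀ i, Submodule ℚ (V i)} (F : Submodule ℚ (⨁ i, V i))
    [Module.Finite ℚ F] (h : ∀ i, ∀ v ∈ S i, DirectSum.lof ℚ ℕ V i v ∈ F) :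
    Module.Finite ℚ (⨁ i, S i) := by
  let f : (⨁ i, S i) →ₗ[ℚ] (⨁ i, V i) := DirectSum.lmap fun i => (S i).subtype
  have hf : Function.Injective f := by
    rw [DirectSum.lmap_injective]
    exact fun i => (S i).injective_subtype
  have hF : ∀ x, f x ∈ F := by
    intro x
    induction x using DirectSum.induction_on with
    | zero => rw [map_zero]; exact zero_mem _
    | of i v =>
      have : f (DirectSum.of _ i v) = DirectSum.lof ℚ ℕ V i v :=
        DirectSum.lmap_lof (fun i => (S i).subtype) i v
      rw [this]
      exact h i v v.2
    | add x y h1 h2 => rw [map_add]; exact add_mem h1 h2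
  exact Module.Finite.of_injective (f.codRestrict F hF)
    fun x y hxy => hf (congrArg Subtype.val hxy)

namespace FinSub

variable (α β : A.FinSub)

theorem finite_space (i : ℕ) : Module.Finite ℚ (α.space i) :=
  haveI := α.finite
  Module.Finite.of_surjective (DirectSum.component ℚ ℕ (fun i => α.carrier i) i)
    fun v => ⟨DirectSum.lof ℚ ℕ _ i v, DirectSum.component.lof_self ℚ i v⟩

/-- The direct sum of the components of `V_α`, as a subspace of the direct sum of those of `V`. -/
def total : Submodule ℚ (⨁ i, V i) :=
  LinearMap.range (DirectSum.lmap fun i => (α.carrier i).subtype)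

instance : Module.Finite ℚ α.total :=
  haveI := α.finite
  inferInstanceAs (Module.Finite ℚ (LinearMap.range _))

theorem lof_mem_total {i : ℕ} {v : V i} (hv : v ∈ α.carrier i) :
    DirectSum.lof ℚ ℕ V i v ∈ α.total :=
  ⟨DirectSum.lof ℚ ℕ _ i ⟨v, hv⟩, DirectSum.lmap_lof (fun i => (α.carrier i).subtype) i ⟨v, hv⟩⟩

theorem d_ι_mem {i : ℕ} {v : V i} (hv : v ∈ α.carrier i) :
    A.d (ι i v) ∈ subalg α.carrier :=
  α.stable _ (Algebra.subset_adjoin (ι_mem_gens_of_mem hv))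

variable (A) in
theorem nonempty : Nonempty A.FinSub :=
  ⟨{ carrier := fun _ => ⊥
     finite := finite_directSum_of_lof_mem ⊥ fun i v hv => by
      rw [(Submodule.mem_bot ℚ).1 hv, map_zero]
      exact zero_mem _
     stable := d_mem_subalg fun i v hv => by
      rw [(Submodule.mem_bot ℚ).1 hv, map_zero, map_zero]
      exact zero_mem _ }⟩

/-- The index set is directed under inclusion: the sum of two finite dimensional stable subspaces is
again one. -/
theorem exists_le_le : ∃ γ : A.FinSub, (∀ i, α.carrier i ≤ γ.carrier i) ∧
    ∀ i, β.carrier i ≤ γ.carrier i := by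
  refine ⟨{ carrier := fun i => α.carrier i ⊔ β.carrier i
            finite := finite_directSum_of_lof_mem (α.total ⊔ β.total) fun i v hv => ?_
            stable := d_mem_subalg fun i v hv => ?_ },
    fun i => le_sup_left, fun i => le_sup_right⟩
  · obtain ⟨a, ha, b, hb, rfl⟩ := Submodule.mem_sup.1 hv
    rw [map_add]
    exact Submodule.add_mem_sup (α.lof_mem_total ha) (β.lof_mem_total hb)
  · obtain ⟨a, ha, b, hb, rfl⟩ := Submodule.mem_sup.1 hv
    rw [map_add, map_add]
    exact add_mem (subalg_mono (fun i => le_sup_left) (α.d_ι_mem ha))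
      (subalg_mono (fun i => le_sup_right) (β.d_ι_mem hb))

theorem exists_mem_of_d_mem {i : ℕ} {v : V i} (hv : A.d (ι i v) ∈ subalg α.carrier) :
    ∃ γ : A.FinSub, v ∈ γ.carrier i := by
  -- The graded line spanned by `v`: it is `ℚ v` in degree `i` and zero elsewhere. Defining it
  -- inside the direct sum avoids transport along equalities of degrees.
  let T : ∀ j, Submodule ℚ (V j) := fun j =>
    (Submodule.span ℚ {DirectSum.lof ℚ ℕ V i v}).comap (DirectSum.lof ℚ ℕ V j)
  refine ⟨{ carrier := fun j => α.carrier j ⊔ T j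
            finite := finite_directSum_of_lof_mem
              (α.total ⊔ Submodule.span ℚ {DirectSum.lof ℚ ℕ V i v}) fun j w hw => ?_
            stable := d_mem_subalg fun j w hw => ?_ },
    (le_sup_right : T i ≤ _) (Submodule.mem_span_singleton_self _)⟩
  · obtain ⟨a, ha, b, hb, rfl⟩ := Submodule.mem_sup.1 hw
    rw [map_add]
    exact Submodule.add_mem_sup (α.lof_mem_total ha) hb
  · obtain ⟨a, ha, b, hb, rfl⟩ := Submodule.mem_sup.1 hw
    obtain ⟨c, hc⟩ := Submodule.mem_span_singleton.1 (show DirectSum.lof ℚ ℕ V j b ∈ _ from hb)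
    have hι : ι j b = c • ι i v := by
      have := congrArg (DirectSum.toModule ℚ ℕ (Free V) ι) hc
      rw [map_smul, DirectSum.toModule_lof, DirectSum.toModule_lof] at this
      exact this.symm
    rw [map_add, map_add, hι, map_smul]
    have hle := subalg_mono (S := α.carrier) (T := fun j => α.carrier j ⊔ T j)
      fun j => le_sup_left
    exact add_mem (hle (α.d_ι_mem ha)) (Subalgebra.smul_mem _ (hle hv) c)

end FinSub

/-- An element of `Λ V(n)` involves finitely many generators, so by induction and directedness it
lies in some `Λ V_α`. If it is `dv`, adjoining `v` to `V_α` keeps stability under `d`. -/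
theorem exists_finSub_mem_of_mem_filtration (n : ℕ) :
    ∀ i, ∀ v ∈ A.filtration n i, ∃ α : A.FinSub, v ∈ α.carrier i := by
  induction n with
  | zero =>
    intro i v hv
    obtain ⟨α⟩ := FinSub.nonempty A
    refine α.exists_mem_of_d_mem ?_
    rw [show A.d (ι i v) = 0 from hv]
    exact zero_mem _
  | succ n ih =>
    have key : ∀ Φ ∈ subalg (A.filtration n), ∃ α : A.FinSub, Φ ∈ subalg α.carrier := by
      intro Φ hΦ
      refine Algebra.adjoin_induction (p := fun Φ _ => ∃ α : A.FinSub, Φ ∈ subalg α.carrier)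
        (fun Φ hΦ => ?_) (fun c => ?_) (fun Φ Ψ _ _ h1 h2 => ?_) (fun Φ Ψ _ _ h1 h2 => ?_) hΦ
      · refine Submodule.iSup_induction _
          (motive := fun Φ => ∃ α : A.FinSub, Φ ∈ subalg α.carrier) hΦ ?_ ?_ ?_
        · rintro i _ ⟨v, hv, rfl⟩
          obtain ⟨α, hα⟩ := ih i v hv
          exact ⟨α, Algebra.subset_adjoin (ι_mem_gens_of_mem hα)⟩
        · obtain ⟨α⟩ := FinSub.nonempty A
          exact ⟨α, zero_mem _⟩
        · rintro Φ Ψ ⟨α, hα⟩ ⟨β, hβ⟩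
          obtain ⟨γ, h1, h2⟩ := α.exists_le_le β
          exact ⟨γ, add_mem (subalg_mono h1 hα) (subalg_mono h2 hβ)⟩
      · obtain ⟨α⟩ := FinSub.nonempty A
        exact ⟨α, Subalgebra.algebraMap_mem _ c⟩
      · obtain ⟨⟨α, hα⟩, ⟨β, hβ⟩⟩ := And.intro h1 h2
        obtain ⟨γ, h1, h2⟩ := α.exists_le_le β
        exact ⟨γ, add_mem (subalg_mono h1 hα) (subalg_mono h2 hβ)⟩
      · obtain ⟨⟨α, hα⟩, ⟨β, hβ⟩⟩ := And.intro h1 h2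
        obtain ⟨γ, h1, h2⟩ := α.exists_le_le β
        exact ⟨γ, mul_mem (subalg_mono h1 hα) (subalg_mono h2 hβ)⟩
    intro i v hv
    obtain ⟨α, hα⟩ := key _ hv
    exact α.exists_mem_of_d_mem hα

theorem IsSullivan.exists_finSub_mem (hS : A.IsSullivan) (i : ℕ) (v : V i) :
    ∃ α : A.FinSub, v ∈ α.carrier i := by
  obtain ⟨n, hn⟩ := hS.2 i v
  exact exists_finSub_mem_of_mem_filtration n i v hn

theorem FinSub.incl_quadD_ι (α : A.FinSub) (i : ℕ) (v : α.space i) :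
    α.incl (α.cdga.quadD (ι i v)) = A.quadD (ι i (v : V i)) := by
  have h : α.incl (ι i v) = ι i (v : V i) := map_ι _ i v
  rw [quadD_ι, quadD_ι, ← h, ← α.incl_d]
  exact map_wedgeProj _ 2 _

/-- The inclusion is injective and commutes with `d₁` on generators, and `Λ² V_n ∩ Λ V_α = Λ² (V_n ∩
V_α)` gives the inductive step. -/
theorem FinSub.quadFiltration_cdga (α : A.FinSub) (n i : ℕ) :
    α.cdga.quadFiltration n i = (A.quadFiltration n i).comap (α.carrier i).subtype := by
  induction n generalizing i with
  | zero =>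
    ext v
    change α.cdga.quadD (ι i v) = 0 ↔ A.quadD (ι i (v : V i)) = 0
    rw [← α.incl_quadD_ι, map_eq_zero_iff _ α.incl_injective]
  | succ n ih =>
    ext v
    change α.cdga.quadD (ι i v) ∈ wedge (α.cdga.quadFiltration n) 2 ↔
      A.quadD (ι i (v : V i)) ∈ wedge (A.quadFiltration n) 2
    rw [← α.incl_quadD_ι, funext ih]
    exact map_subtype_mem_wedge_two.symm

/-- The Sullivan lower central series is the annihilator of the filtration defined by `d₁`. -/
theorem IsSullivan.sullivanLCS_eq (hS : A.IsSullivan) (n p : ℕ) :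
    A.sullivanLCS (n + 2) p = (A.quadFiltration n (p + 1)).dualAnnihilator := by
  have h (α : A.FinSub) : α.cdga.lcs (n + 2) p =
      ((A.quadFiltration n (p + 1)).comap (α.carrier (p + 1)).subtype).dualAnnihilator := by
    have := hS.1
    have := α.finite_space
    rw [α.cdga.lcs_eq_dualAnnihilator inferInstance, α.quadFiltration_cdga]
  ext x
  simp only [sullivanLCS, Submodule.mem_iInf, Submodule.mem_comap, h,
    Submodule.mem_dualAnnihilator]
  constructor
  · intro hx v hv
    -- The condition on `x` is tested one vector at a time, so a single `V_α` containing `v`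
    -- suffices.
    obtain ⟨α, hα⟩ := hS.exists_finSub_mem (p + 1) v
    exact hx α ⟨v, hα⟩ hv
  · intro hx α v hv
    exact hx v hv

end FinSub

/-! ### The image of `ξ` -/

section Hurewicz

variable {A : FreeCDGA V}

/-- By minimality, only the components of `Φ` in wedge degrees 0 and 1 contribute to the wedge
degree 2 part of `dΦ`. Constants are killed by `d`, so this part is `d₁` of the linear part of `Φ`,
and it vanishes for a cocycle. -/
theorem IsMinimal.xi_mem (hM : A.IsMinimal) (n : ℕ) (c : A.H n) :
    A.xi hM n c ∈ A.quadFiltration 0 n := by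
  obtain ⟨⟨Φ, hΦ⟩, rfl⟩ := Submodule.Quotient.mk_surjective _ c
  change A.quadD (ι n (DirectSum.component ℚ ℕ V n (linPart Φ))) = 0
  have h := hM.wedgeProj_d_eq_sum 2 Φ
  rw [show A.d Φ = 0 from hΦ.1, map_zero, Finset.sum_range_succ, Finset.sum_range_one] at h
  have h0 : A.d (wedgeProj 0 Φ) = 0 := by
    have := wedgeProj_mem 0 Φ
    rw [wedge, pow_zero] at this
    obtain ⟨c, hc⟩ := Submodule.mem_one.1 this
    rw [← hc, Algebra.algebraMap_eq_smul_one, map_smul, d_one, smul_zero]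
  rw [h0, map_zero, zero_add, wedgeProj_one_eq hΦ.2] at h
  rw [quadD_ι, ← h]

theorem quadratic_quadFiltration_zero (hM : A.IsMinimal) (i : ℕ) :
    (A.quadratic hM).quadFiltration 0 i = A.quadFiltration 0 i := by
  ext v
  change (A.quadratic hM).quadD (ι i v) = 0 ↔ A.quadD (ι i v) = 0
  have h : (A.quadratic hM).quadD (ι i v) = A.quadD (ι i v) := by
    rw [quadD_ι]
    change wedgeProj 2 (A.quadD (ι i v)) = _
    rw [quadD_ι, wedgeProj_of_mem (wedgeProj_mem 2 _), if_pos rfl]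
  rw [h]

/-- A vector `v ∈ V_0` is itself a cocycle for `d₁`. For `d` this can fail, since `dv` may have
components of higher wedge degree. -/
theorem exists_xi_quadratic_eq (hM : A.IsMinimal) {n : ℕ} {v : V n}
    (hv : v ∈ A.quadFiltration 0 n) :
    ∃ c, (A.quadratic hM).xi (quadratic_isMinimal hM) n c = v := by
  refine ⟨Submodule.Quotient.mk ⟨ι n v, hv, ι_mem_degPart n v⟩, ?_⟩
  change DirectSum.component ℚ ℕ V n (linPart (ι n v)) = v
  rw [linPart_ι, DirectSum.component.lof_self]

end Hurewicz

end FreeCDGA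

end Sullivan

end

/-! ### The isomorphisms and the Hurewicz factorizations -/

theorem proposition6 {V : ℕ → Type*} [∀ i, AddCommGroup (V i)] [∀ i, Module ℚ (V i)]
    (A : Sullivan.FreeCDGA V) (hS : A.IsSullivan) (hM : A.IsMinimal) :
    -- restriction to `V_n` induces isomorphisms `L_V / L_V^{(n+2)} ≅ V_n^∨` of degree one
    (∀ n p : ℕ, ∃ e : (Sullivan.FreeCDGA.L V p ⧸ A.sullivanLCS (n + 2) p) ≃ₗ[ℚ]
        Module.Dual ℚ (A.quadFiltration n (p + 1)),
      ∀ x : Sullivan.FreeCDGA.L V p,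
        e (Submodule.Quotient.mk x) = (A.quadFiltration n (p + 1)).dualRestrict x) ∧
    -- equivalently, `L_V^{(n+2)} ≅ (V / V_n)^∨`
    (∀ n p : ℕ, ∃ e : A.sullivanLCS (n + 2) p ≃ₗ[ℚ]
        Module.Dual ℚ (V (p + 1) ⧸ A.quadFiltration n (p + 1)),
      ∀ (x : A.sullivanLCS (n + 2) p) (v : V (p + 1)),
        e x (Submodule.Quotient.mk v) = (x : Sullivan.FreeCDGA.L V p) v) ∧
    -- the Hurewicz map of `(Λ V, d)` factors through `L_V / L_V^{(2)}`
    (∀ p : ℕ, ∃ h : (Sullivan.FreeCDGA.L V p ⧸ A.sullivanLCS 2 p) →ₗ[ℚ]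
        Module.Dual ℚ (A.H (p + 1)),
      ∀ x : Sullivan.FreeCDGA.L V p, A.hurewicz hM p x = h (Submodule.Quotient.mk x)) ∧
    -- the Hurewicz map of `(Λ V, d₁)` factors as
    -- `L_V → L_V / L_V^{(2)} ≅ V_0^∨ ⊆ H^{≥ 1}(Λ V, d₁)^∨`
    (∀ p : ℕ, ∃ (ξ₀ : (A.quadratic hM).H (p + 1) →ₗ[ℚ] A.quadFiltration 0 (p + 1))
        (e : (Sullivan.FreeCDGA.L V p ⧸ A.sullivanLCS 2 p) ≃ₗ[ℚ]
          Module.Dual ℚ (A.quadFiltration 0 (p + 1))),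
      (∀ c, (ξ₀ c : V (p + 1)) =
        (A.quadratic hM).xi (Sullivan.FreeCDGA.quadratic_isMinimal hM) (p + 1) c) ∧
      Function.Surjective ξ₀ ∧
      Function.Injective ξ₀.dualMap ∧
      (∀ x : Sullivan.FreeCDGA.L V p,
        e (Submodule.Quotient.mk x) = (A.quadFiltration 0 (p + 1)).dualRestrict x) ∧
      (∀ x : Sullivan.FreeCDGA.L V p,
        (A.quadratic hM).hurewicz (Sullivan.FreeCDGA.quadratic_isMinimal hM) p x =
          ξ₀.dualMap (e (Submodule.Quotient.mk x)))) := by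
  have hL := hS.sullivanLCS_eq
  have ha : ∀ n p : ℕ, ∃ e : (Sullivan.FreeCDGA.L V p ⧸ A.sullivanLCS (n + 2) p) ≃ₗ[ℚ]
      Module.Dual ℚ (A.quadFiltration n (p + 1)), ∀ x : Sullivan.FreeCDGA.L V p,
        e (Submodule.Quotient.mk x) = (A.quadFiltration n (p + 1)).dualRestrict x := by
    intro n p
    exact ⟨(Submodule.quotEquivOfEq _ _ (hL n p)).trans (Subspace.quotAnnihilatorEquiv _),
      fun x => rfl⟩
  refine ⟨ha, fun n p => ?_, fun p => ?_, fun p => ?_⟩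
  · exact ⟨(LinearEquiv.ofEq _ _ (hL n p)).trans
      (Submodule.dualQuotEquivDualAnnihilator _).symm, fun x v => rfl⟩
  · refine ⟨(A.sullivanLCS 2 p).liftQ (A.hurewicz hM p) fun x hx => ?_, fun x => rfl⟩
    rw [hL 0 p, Submodule.mem_dualAnnihilator] at hx
    -- An element of `L_V^{(2)}` vanishes on `V_0`, which contains the image of `ξ`.
    exact LinearMap.ext fun c => hx _ (hM.xi_mem (p + 1) c)
  · obtain ⟨e, he⟩ := ha 0 p
    have hmem := (Sullivan.FreeCDGA.quadratic_isMinimal hM).xi_mem (p + 1)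
    -- The quadratic part of `d₁` on generators is `d₁` itself, so `(Λ V, d)` and `(Λ V, d₁)` share
    -- the same `V_0`.
    rw [Sullivan.FreeCDGA.quadratic_quadFiltration_zero] at hmem
    have hsurj : Function.Surjective (LinearMap.codRestrict _ _ hmem) := by
      rintro ⟨v, hv⟩
      obtain ⟨c, hc⟩ := Sullivan.FreeCDGA.exists_xi_quadratic_eq hM hv
      exact ⟨c, Subtype.ext hc⟩
    refine ⟨LinearMap.codRestrict _ _ hmem, e, fun c => rfl, hsurj,
      LinearMap.dualMap_injective_of_surjective hsurj, he, fun x => ?_⟩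
    exact (congrArg (LinearMap.codRestrict _ _ hmem).dualMap (he x)).symm
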